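/- Let $V:\mathbb R\to\mathbb R$ be continuous with $V(x+1)=V(x)$, and let $e^{-i\omega(\epsilon)t}\phi(x,\epsilon)$, $|\epsilon|<\delta$, be a family of standing waves of $i\psi_t=-\tfrac12\psi_{xx}+\epsilon|\psi|^2\psi+V(x)\psi$, where $\phi$ is real valued, of class $C^2$ in $(x,\epsilon)$, $1$-periodic or $1$-antiperiodic in $x$, and $\phi(\cdot,0)\not\equiv0$. Put $L_-=-\tfrac12\partial_{xx}+V+\epsilon|\phi|^2-\omega(\epsilon)$ and $L_+=-\tfrac12\partial_{xx}+V+3\epsilon|\phi|^2-\omega(\epsilon)$. For $\mu\in\mathbb C$ let $M=M(\mu,\epsilon)$ be the $4\times4$ monodromy matrix (over one period) of the linearized stability problem $L_+p=\mu q,\ L_-q=\mu p$, written as a first order system for $(p,p_x,q,q_x)$, and let $$K_\pm=\tfrac12\Bigl(\operatorname{Tr}M\pm\sqrt{-(\operatorname{Tr}M)^2+2\operatorname{Tr}(M^2)+8}\Bigr)$$ be its Floquet discriminants (principal branch of the root). Let $k(\mu)$ be the trace of the $2\times 2$ monodromy matrix of $-\tfrac12\psi''+(V-\omega(0))\psi=\mu\psi$.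 Let $\mu^*\in\mathbb C$ be a point with $k(\mu^*)=k(-\mu^*)$. Then there are constants $\alpha,\beta,\gamma\in\mathbb C$ such that, for all complex $\mu$ near $\mu^*$ and all real $\epsilon$ near $0$, $$K_\pm(\mu,\epsilon)=k(\mu^*)+\tfrac12\bigl(k'(\mu^*)-k'(-\mu^*)\bigr)(\mu-\mu^*)+\alpha\epsilon+E_1\pm\tfrac12\sqrt{\bigl(k'(\mu^*)+k'(-\mu^*)\bigr)^2(\mu-\mu^*)^2+\beta\epsilon(\mu-\mu^*)+\gamma\epsilon^2+E_2},$$ with the same $E_1,E_2$ for both signs and $$E_1=O\bigl(\epsilon^2,(\mu-\mu^*)^2,\epsilon(\mu-\mu^*)\bigr),\qquad E_2=O\bigl(\epsilon^3,(\mu-\mu^*)^3,\epsilon(\mu-\mu^*)^2,\epsilon^2(\mu-\mu^*)\bigr).$$ If $\mu^*$ is real, then $\alpha,\beta,\gamma$ are real. If moreover $-2<k(\mu^*)<2$ (so that the colliding eigenvalues of $M(\mu^*,0)$ lie on the unit circle) and $\operatorname{sgn}k'(\mu^*)=\operatorname{sgn}k'(-\mu^*)$ (like Krein signs), then the quadratic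 form $$(s,e)\mapsto\bigl(k'(\mu^*)+k'(-\mu^*)\bigr)^2s^2+\beta es+\gamma e^2$$ is nonnegative on $\mathbb R^2$. -/

import Mathlib

open Set

section LinearODE

/-- `U` is the solution operator (principal fundamental matrix) of the linear system
`U' = A(x) U`, `U(0) = 1`. -/
def IsSolutionOperator {n : Type*} [Fintype n] [DecidableEq n]
    (A U : ℝ → Matrix n n ℂ) : Prop :=
  U 0 = 1 ∧ ∀ x i j, HasDerivAt (fun y => U y i j) ((A x * U x) i j) x

/-- Terms of the Picard iteration for `u' = a(x) u`, `u(0) = 1`, in a Banach algebra. -/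
noncomputable def picardTerm {R : Type*} [NormedRing R] [NormedAlgebra ℝ R]
    (a : ℝ → R) : ℕ → ℝ → R
  | 0 => fun _ => 1
  | k + 1 => fun x => ∫ t in (0 : ℝ)..x, a t * picardTerm a k t

theorem continuous_picardTerm {R : Type*} [NormedRing R] [NormedAlgebra ℝ R] [CompleteSpace R]
    {a : ℝ → R} (ha : Continuous a) (k : ℕ) : Continuous (picardTerm a k) := by
  induction k with
  | zero => exact continuous_const
  | succ k ih =>
    exact intervalIntegral.continuous_primitive
      (fun _ _ => (ha.mul ih).intervalIntegrable _ _) 0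

theorem norm_picardTerm_le {R : Type*} [NormedRing R] [NormedAlgebra ℝ R] [CompleteSpace R]
    {a : ℝ → R} (ha : Continuous a) {T C : ℝ}
    (hC : ∀ x, |x| ≤ T → ‖a x‖ ≤ C) (k : ℕ) :
    ∀ x, |x| ≤ T → ‖picardTerm a k x‖ ≤ ‖(1 : R)‖ * (C ^ k * |x| ^ k / k.factorial) := by
  induction k with
  | zero => intro x _; simp [picardTerm]
  | succ k ih =>
    intro x hx
    have hC0 : 0 ≤ C := le_trans (norm_nonneg _) (hC x hx)
    have hsub : ∀ t ∈ uIoc (0 : ℝ) x, |t| ≤ T := by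
      intro t ht
      refine le_trans ?_ hx
      rcases le_total 0 x with h | h
      · rw [uIoc_of_le h] at ht
        rw [abs_of_pos ht.1, abs_of_nonneg h]; exact ht.2
      · rw [uIoc_of_ge h] at ht
        rw [abs_of_nonpos ht.2, abs_of_nonpos h]; linarith [ht.1]
    have hint : MeasureTheory.IntegrableOn
        (fun t => ‖(1 : R)‖ * (C ^ (k + 1) / k.factorial) * |t - 0| ^ k) (uIoc 0 x) := by
      have : Continuous fun t : ℝ => ‖(1 : R)‖ * (C ^ (k + 1) / k.factorial) * |t - 0| ^ k := by
        fun_prop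
      exact intervalIntegrable_iff.1 (this.intervalIntegrable 0 x)
    have hint2 : MeasureTheory.IntegrableOn (fun t => ‖a t * picardTerm a k t‖)
        (uIoc 0 x) :=
      intervalIntegrable_iff.1
        (((ha.mul (continuous_picardTerm ha k)).norm).intervalIntegrable 0 x)
    calc ‖picardTerm a (k + 1) x‖
        ≤ ∫ t in uIoc (0 : ℝ) x, ‖a t * picardTerm a k t‖ :=
          intervalIntegral.norm_integral_le_integral_norm_uIoc
      _ ≤ ∫ t in uIoc (0 : ℝ) x, ‖(1 : R)‖ * (C ^ (k + 1) / k.factorial) * |t - 0| ^ k := by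
          refine MeasureTheory.setIntegral_mono_on hint2 hint measurableSet_uIoc ?_
          intro t ht
          have h1 := hC t (hsub t ht)
          have h2 := ih t (hsub t ht)
          calc ‖a t * picardTerm a k t‖ ≤ ‖a t‖ * ‖picardTerm a k t‖ := norm_mul_le _ _
            _ ≤ C * (‖(1 : R)‖ * (C ^ k * |t| ^ k / k.factorial)) :=
                mul_le_mul h1 h2 (norm_nonneg _) hC0
            _ = _ := by rw [sub_zero]; ring
      _ = ‖(1 : R)‖ * (C ^ (k + 1) * |x| ^ (k + 1) / (k + 1).factorial) := by
          rw [MeasureTheory.integral_const_mul, integral_pow_abs_sub_uIoc, sub_zero,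
            Nat.factorial_succ]
          push_cast
          field_simp

theorem exists_linear_ode_solution {R : Type*} [NormedRing R] [NormedAlgebra ℝ R]
    [CompleteSpace R] {a : ℝ → R} (ha : Continuous a) :
    ∃ u : ℝ → R, u 0 = 1 ∧ ∀ x, HasDerivAt u (a x * u x) x := by
  have hb : ∀ T : ℝ, ∃ C, ∀ x, |x| ≤ T → ‖a x‖ ≤ C := by
    intro T
    obtain ⟨C, hC⟩ := (isCompact_Icc (a := -T) (b := T)).exists_bound_of_continuousOn
      ha.continuousOn
    exact ⟨C, fun x hx => hC x (abs_le.1 hx)⟩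
  have hbound : ∀ T : ℝ, ∃ v : ℕ → ℝ, Summable v ∧
      ∀ k x, |x| ≤ T → ‖picardTerm a k x‖ ≤ v k := by
    intro T
    obtain ⟨C, hC⟩ := hb T
    refine ⟨fun k => ‖(1 : R)‖ * ((C * T) ^ k / k.factorial),
      (Real.summable_pow_div_factorial _).mul_left _, ?_⟩
    intro k x hx
    have hC0 : 0 ≤ C := le_trans (norm_nonneg _) (hC x hx)
    refine (norm_picardTerm_le ha hC k x hx).trans ?_
    simp only [mul_pow]
    gcongr
  refine ⟨fun x => ∑' k, picardTerm a k x, ?_, ?_⟩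
  · change ∑' k, picardTerm a k 0 = 1
    rw [tsum_eq_single 0]
    · rfl
    · intro k hk
      obtain ⟨m, rfl⟩ := Nat.exists_eq_succ_of_ne_zero hk
      simp [picardTerm]
  · intro x
    obtain ⟨v, hv, hvb⟩ := hbound (|x| + 1)
    obtain ⟨C, hC⟩ := hb (|x| + 1)
    have hball : ∀ y ∈ Metric.ball (0 : ℝ) (|x| + 1), |y| ≤ |x| + 1 := by
      intro y hy
      simpa using (Metric.mem_ball.1 hy).le
    have hsum : ∀ y, |y| ≤ |x| + 1 → Summable fun k => picardTerm a k y := fun y hy =>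
      Summable.of_norm_bounded hv (fun k => hvb k y hy)
    let g' : ℕ → ℝ → R := fun k y => Nat.casesOn k 0 (fun m => a y * picardTerm a m y)
    have hg : ∀ k y, HasDerivAt (picardTerm a k) (g' k y) y := by
      intro k y
      cases k with
      | zero => exact hasDerivAt_const y (1 : R)
      | succ m =>
        exact (ha.mul (continuous_picardTerm ha m)).integral_hasStrictDerivAt 0 y
          |>.hasDerivAt
    have hu : Summable fun k : ℕ => (Nat.casesOn k 0 (fun m => C * v m) : ℝ) := by
      rw [← summable_nat_add_iff 1]
      exact hv.mul_left C
    have hx0 : x ∈ Metric.ball (0 : ℝ) (|x| + 1) := by simp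
    have hC0 : 0 ≤ C := le_trans (norm_nonneg _) (hC x (hball x hx0))
    have key := hasDerivAt_tsum_of_isPreconnected (g := picardTerm a) (g' := g') hu
      Metric.isOpen_ball (convex_ball (0 : ℝ) (|x| + 1)).isPreconnected
      (fun k y _ => hg k y)
      (fun k y hy => by
        cases k with
        | zero => simp [g']
        | succ m =>
          exact (norm_mul_le _ _).trans
            (mul_le_mul (hC y (hball y hy)) (hvb m y (hball y hy)) (norm_nonneg _) hC0))
      hx0 (hsum x (hball x hx0)) hx0
    have hs := hsum x (hball x hx0)
    have hs' : Summable fun k => g' k x := by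
      rw [← summable_nat_add_iff 1]
      exact hs.mul_left (a x)
    have : ∑' k, g' k x = a x * ∑' k, picardTerm a k x := by
      rw [hs'.tsum_eq_zero_add, ← hs.tsum_mul_left]
      simp [g']
    rw [← this]
    exact key

/-- A linear system with continuous coefficients has a solution operator. -/
theorem exists_isSolutionOperator {n : Type*} [Fintype n] [DecidableEq n]
    {A : ℝ → Matrix n n ℂ} (hA : Continuous A) : ∃ U, IsSolutionOperator A U := by
  let _ : NormedRing (Matrix n n ℂ) := Matrix.linftyOpNormedRing
  let _ : NormedAlgebra ℝ (Matrix n n ℂ) := Matrix.linftyOpNormedAlgebra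
  have _ : CompleteSpace (Matrix n n ℂ) := FiniteDimensional.complete ℝ _
  obtain ⟨u, hu0, hu⟩ := exists_linear_ode_solution hA
  refine ⟨u, hu0, fun x i j => ?_⟩
  let L : Matrix n n ℂ →L[ℝ] ℂ := LinearMap.toContinuousLinearMap
    { toFun := fun M => M i j, map_add' := fun _ _ => rfl, map_smul' := fun _ _ => rfl }
  exact L.hasFDerivAt.comp_hasDerivAt x (hu x)

/-- The monodromy matrix (period map) `U(1)` of the 1-periodic system `U' = A(x) U`, `U(0) = 1`,
where `U` is the solution operator. It exists for all continuous `A`. -/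
noncomputable def monodromy {n : Type*} [Fintype n] [DecidableEq n]
    (A : ℝ → Matrix n n ℂ) : Matrix n n ℂ :=
  open Classical in if h : ∃ U, IsSolutionOperator A U then h.choose 1 else 0

theorem monodromy_eq {n : Type*} [Fintype n] [DecidableEq n] {A U : ℝ → Matrix n n ℂ}
    (hA : Continuous A) (hU : IsSolutionOperator A U) : monodromy A = U 1 := by
  let _ : NormedRing (Matrix n n ℂ) := Matrix.linftyOpNormedRing
  let _ : NormedAlgebra ℝ (Matrix n n ℂ) := Matrix.linftyOpNormedAlgebra
  have hex : ∃ U, IsSolutionOperator A U := ⟨U, hU⟩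
  rw [monodromy, dif_pos hex]
  have hW := hex.choose_spec
  generalize hex.choose = W at hW
  obtain ⟨C, hC⟩ := (isCompact_Icc (a := (0 : ℝ)) (b := 1)).exists_bound_of_continuousOn
    hA.continuousOn
  have hd : ∀ {Z : ℝ → Matrix n n ℂ}, IsSolutionOperator A Z →
      ∀ x, HasDerivAt Z (A x * Z x) x := by
    intro Z hZ x
    exact hasDerivAt_pi.2 fun i => hasDerivAt_pi.2 fun j => hZ.2 x i j
  have := ODE_solution_unique_of_mem_Icc_right (v := fun x Z => A x * Z)
    (s := fun _ => univ) (K := C.toNNReal) (f := W) (g := U) (a := 0) (b := 1)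
    (fun t ht => by
      refine LipschitzOnWith.of_dist_le_mul fun X _ Y _ => ?_
      rw [dist_eq_norm, dist_eq_norm, ← mul_sub]
      refine (norm_mul_le _ _).trans ?_
      gcongr
      exact (hC t ⟨ht.1, ht.2.le⟩).trans (Real.le_coe_toNNReal C))
    (fun x _ => (hd hW x).continuousAt.continuousWithinAt)
    (fun x _ => (hd hW x).hasDerivWithinAt) (fun _ _ => mem_univ _)
    (fun x _ => (hd hU x).continuousAt.continuousWithinAt)
    (fun x _ => (hd hU x).hasDerivWithinAt) (fun _ _ => mem_univ _)
    (by rw [hW.1, hU.1])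
  exact this ⟨zero_le_one, le_rfl⟩

end LinearODE

section StandingWaves

/-- Hill's equation `-ψ''/2 + (V - ω₀) ψ = μ ψ` as a first order system for `(ψ, ψ')`. -/
noncomputable def hillMatrix (V : ℝ → ℝ) (ω₀ : ℝ) (μ : ℂ) (x : ℝ) : Matrix (Fin 2) (Fin 2) ℂ :=
  !![0, 1;
     2 * ((V x : ℂ) - ω₀ - μ), 0]

/-- The Floquet discriminant `k(μ) = Tr m(μ)` of Hill's equation. -/
noncomputable def hillDiscriminant (V : ℝ → ℝ) (ω₀ : ℝ) (μ : ℂ) : ℂ :=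
  (monodromy (hillMatrix V ω₀ μ)).trace

/-- A family `e^{-iω(ε)t} φ(x,ε)`, `|ε| < δ`, of real standing waves of
`i ψ_t = -ψ_xx/2 + ε |ψ|² ψ + V ψ`, of class `C²` in `(x, ε)`, periodic or antiperiodic in `x`,
which bifurcates from an eigenfunction `φ(·,0)` of the linear problem. -/
structure IsStandingWaveFamily (V : ℝ → ℝ) (δ : ℝ) (φ : ℝ → ℝ → ℝ) (ω : ℝ → ℝ) : Prop where
  pos : 0 < δ
  contDiffOn : ContDiffOn ℝ 2 (fun p : ℝ × ℝ => φ p.1 p.2) (univ ×ˢ Ioo (-δ) δ)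
  periodic_or_antiperiodic :
    (∀ ε ∈ Ioo (-δ) δ, ∀ x, φ (x + 1) ε = φ x ε) ∨
    (∀ ε ∈ Ioo (-δ) δ, ∀ x, φ (x + 1) ε = -φ x ε)
  equation : ∀ ε ∈ Ioo (-δ) δ, ∀ x,
    -(1 / 2) * deriv (deriv fun y => φ y ε) x + ε * |φ x ε| ^ 2 * φ x ε + V x * φ x ε
      = ω ε * φ x ε
  nontrivial : ∃ x, φ x 0 ≠ 0

/-- The linearized stability problem `L₊ p = μ q`, `L₋ q = μ p` with
`L₊ = -∂ₓₓ/2 + V + 3ε|φ|² - ω(ε)`, `L₋ = -∂ₓₓ/2 + V + ε|φ|² - ω(ε)`,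
as a first order system for `(p, p', q, q')`. -/
noncomputable def stabilityMatrix (V : ℝ → ℝ) (φ : ℝ → ℝ → ℝ) (ω : ℝ → ℝ) (μ : ℂ) (ε : ℝ)
    (x : ℝ) : Matrix (Fin 4) (Fin 4) ℂ :=
  !![0, 1, 0, 0;
     2 * ((V x + 3 * ε * |φ x ε| ^ 2 - ω ε : ℝ) : ℂ), 0, -2 * μ, 0;
     0, 0, 0, 1;
     -2 * μ, 0, 2 * ((V x + ε * |φ x ε| ^ 2 - ω ε : ℝ) : ℂ), 0]

/-- The Floquet discriminant `K₊ = (Tr M + √(-(Tr M)² + 2 Tr M² + 8)) / 2` of a `4 × 4`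
monodromy matrix (`Complex.sqrt` is the principal branch); one has
`det (λ - M) = (1 - K₊ λ + λ²) (1 - K₋ λ + λ²)` for symplectic `M`. -/
noncomputable def discriminantPlus (M : Matrix (Fin 4) (Fin 4) ℂ) : ℂ :=
  (M.trace + Complex.sqrt (-M.trace ^ 2 + 2 * (M ^ 2).trace + 8)) / 2

/-- The Floquet discriminant `K₋ = (Tr M - √(-(Tr M)² + 2 Tr M² + 8)) / 2`. -/
noncomputable def discriminantMinus (M : Matrix (Fin 4) (Fin 4) ℂ) : ℂ :=
  (M.trace - Complex.sqrt (-M.trace ^ 2 + 2 * (M ^ 2).trace + 8)) / 2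

end StandingWaves

/-!
Write `s = μ - μ*`. In the coordinates `(p + q, p' + q', p - q, p' - q')` the stability problem at
`ε = 0` splits into two Hill equations, with parameters `μ` and `-μ`; for `ε ≠ 0` they are coupled
at order `ε`. Let `a, b, c, d` be the `2 × 2` blocks of the monodromy matrix in these coordinates.
Conservation of the Wronskian gives `det a + det c = det b + det d = 1`, and then
`-(Tr M)² + 2 Tr M² + 8 = (tr a - tr d)² + 4 det (b + adj c)` (`radicand_fromBlocks`). At `(μ*, 0)`
the blocks `a` and `d` have equal traces and `b = c = 0`, so the right hand side is quadratic in
quantities that vanish there. Hence the first order expansion of `M`, with a remainder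
`O((|s| + |ε|)²)`, yields the radicand up to `O((|s| + |ε|)³)`; the error terms `E₁` and `E₂` are
simply defined as the remainders.

The expansion of `M` (`exists_norm_monodromy_coupledHillMatrix_sub_le`) comes from variation of
constants and Gronwall's inequality. Its inputs are `φ(x, ε) = φ(x, 0) + O(ε)`, from the regularity
of `φ`, and `ω(ε) = ω(0) + ω₁ ε + O(ε²)`. The latter follows by integrating the derivative of the
Wronskian of `φ(·, ε)` and `φ(·, 0)` over a period:
`(ω(ε) - ω(0)) ∫ φ(x, ε) φ(x, 0) = ε ∫ φ(x, ε)³ φ(x, 0)`.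

With `m₁, m₂` the Hill monodromy matrices at `μ*` and `-μ*`, the first order part of
`b + adj c` is `ε Y`, where `Y = m₁ B - B m₂⁻¹` for a matrix `B`, and the quadratic form is
`((k'(μ*) + k'(-μ*)) s + t e)² + 4 det Y e²`. By the Cayley-Hamilton theorem `m₁ Y = Y m₂`. Inside
a band `m₁` and `m₂` are elliptic, and the sign of `-k'` is their direction of rotation
(`mul_deriv_hillDiscriminant_neg`). When the directions agree, an intertwiner `Y` cannot reverse
orientation, so `det Y ≥ 0` (`det_mul_sub_mul_adjugate_nonneg`).
-/

/-! ### Perturbation of linear systems -/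

section Perturbation

/-- First order expansion of the solution of `W' = B W`, `W(0) = 1`, for small `B`. -/
theorem norm_sub_one_sub_integral_le {R : Type*} [NormedRing R] [NormedAlgebra ℝ R]
    [CompleteSpace R] {B W : ℝ → R} (hB : Continuous B) (hW0 : W 0 = 1)
    (hW : ∀ x, HasDerivAt W (B x * W x) x) {b K : ℝ} (hbK : b ≤ K)
    (hb : ∀ x ∈ Icc (0 : ℝ) 1, ‖B x‖ ≤ b) :
    ‖W 1 - 1 - ∫ x in (0 : ℝ)..1, B x‖ ≤ ‖(1 : R)‖ * Real.exp K * b ^ 2 := by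
  have hWc : Continuous W := continuous_iff_continuousAt.2 fun x => (hW x).continuousAt
  have hb0 : 0 ≤ b := (norm_nonneg _).trans (hb 0 ⟨le_rfl, zero_le_one⟩)
  have hWb : ∀ x ∈ Icc (0 : ℝ) 1, ‖W x‖ ≤ ‖(1 : R)‖ * Real.exp K := by
    intro x hx
    have := norm_le_gronwallBound_of_norm_deriv_right_le (f := W) (f' := fun x => B x * W x)
      (δ := ‖(1 : R)‖) (K := b) (ε := 0) (a := 0) (b := 1) hWc.continuousOn
      (fun y _ => (hW y).hasDerivWithinAt) (by rw [hW0])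
      (fun y hy => by
        rw [add_zero]
        exact (norm_mul_le _ _).trans
          (mul_le_mul_of_nonneg_right (hb y ⟨hy.1, hy.2.le⟩) (norm_nonneg _))) x hx
    refine this.trans ?_
    rw [gronwallBound_ε0]
    gcongr
    have := hx.1
    have := hx.2
    nlinarith
  have hint : ∀ x, W x - 1 = ∫ t in (0 : ℝ)..x, B t * W t := by
    intro x
    rw [intervalIntegral.integral_eq_sub_of_hasDerivAt (fun y _ => hW y)
      ((hB.mul hWc).intervalIntegrable _ _), hW0]
  have hW1 : ∀ x ∈ Icc (0 : ℝ) 1, ‖W x - 1‖ ≤ b * (‖(1 : R)‖ * Real.exp K) := by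
    intro x hx
    rw [hint]
    refine (intervalIntegral.norm_integral_le_of_norm_le_const
      (C := b * (‖(1 : R)‖ * Real.exp K)) ?_).trans ?_
    · intro t ht
      rw [uIoc_of_le hx.1] at ht
      have ht' : t ∈ Icc (0 : ℝ) 1 := ⟨ht.1.le, ht.2.trans hx.2⟩
      exact (norm_mul_le _ _).trans (mul_le_mul (hb t ht') (hWb t ht') (norm_nonneg _) hb0)
    · rw [sub_zero, abs_of_nonneg hx.1]
      exact mul_le_of_le_one_right (by positivity) hx.2
  have hfin : W 1 - 1 - ∫ x in (0 : ℝ)..1, B x = ∫ x in (0 : ℝ)..1, B x * (W x - 1) := by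
    simp only [mul_sub, mul_one]
    rw [hint]
    exact (intervalIntegral.integral_sub ((hB.mul hWc).intervalIntegrable _ _)
      (hB.intervalIntegrable _ _)).symm
  rw [hfin]
  refine (intervalIntegral.norm_integral_le_of_norm_le_const
      (C := b * (b * (‖(1 : R)‖ * Real.exp K))) ?_).trans (le_of_eq ?_)
  · intro t ht
    rw [uIoc_of_le zero_le_one] at ht
    have ht' : t ∈ Icc (0 : ℝ) 1 := ⟨ht.1.le, ht.2⟩
    exact (norm_mul_le _ _).trans (mul_le_mul (hb t ht') (hW1 t ht') (norm_nonneg _) hb0)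
  · simp; ring

/-- First order perturbation theory for `U' = A U` around `U₀' = A₀ U₀`, where `A` differs from
`A₀` by a first order term `E` and a remainder of second order. The inverse of `U₀` is `Z₀`. -/
theorem exists_norm_solution_sub_le {R : Type*} [NormedRing R] [NormedAlgebra ℝ R]
    [CompleteSpace R] {A₀ U₀ Z₀ : ℝ → R}
    (hU₀ : ∀ x, HasDerivAt U₀ (A₀ x * U₀ x) x)
    (hZ₀0 : Z₀ 0 = 1) (hZ₀ : ∀ x, HasDerivAt Z₀ (-(Z₀ x * A₀ x)) x)
    (hUZ : ∀ x, U₀ x * Z₀ x = 1) (hA₀ : Continuous A₀) {K : ℝ} (hK : 0 ≤ K) :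
    ∃ C : ℝ, ∀ (A U E : ℝ → R) (η : ℝ), Continuous A → Continuous E → U 0 = 1 →
      (∀ x, HasDerivAt U (A x * U x) x) → 0 ≤ η → η ≤ 1 →
      (∀ x ∈ Icc (0 : ℝ) 1, ‖E x‖ ≤ K * η) →
      (∀ x ∈ Icc (0 : ℝ) 1, ‖A x - A₀ x - E x‖ ≤ K * η ^ 2) →
      ‖U 1 - U₀ 1 * (1 + ∫ x in (0 : ℝ)..1, Z₀ x * E x * U₀ x)‖ ≤ C * η ^ 2 := by
  have hUc : Continuous U₀ := continuous_iff_continuousAt.2 fun x => (hU₀ x).continuousAt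
  have hZc : Continuous Z₀ := continuous_iff_continuousAt.2 fun x => (hZ₀ x).continuousAt
  obtain ⟨c, hc⟩ := (isCompact_Icc (a := (0 : ℝ)) (b := 1)).exists_bound_of_continuousOn
    hUc.continuousOn
  obtain ⟨d, hd⟩ := (isCompact_Icc (a := (0 : ℝ)) (b := 1)).exists_bound_of_continuousOn
    hZc.continuousOn
  have h0 : (0 : ℝ) ∈ Icc (0 : ℝ) 1 := ⟨le_rfl, zero_le_one⟩
  have hc0 : 0 ≤ c := (norm_nonneg _).trans (hc 0 h0)
  have hd0 : 0 ≤ d := (norm_nonneg _).trans (hd 0 h0)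
  refine ⟨c * (‖(1 : R)‖ * Real.exp (2 * (d * K * c)) * (2 * (d * K * c)) ^ 2 + d * K * c), ?_⟩
  intro A U E η hA hE hU0 hU hη hη1 hEb hRb
  have hsand : ∀ (F : R) (x : ℝ) (e : ℝ), x ∈ Icc (0 : ℝ) 1 → ‖F‖ ≤ e →
      ‖Z₀ x * F * U₀ x‖ ≤ d * e * c := by
    intro F x e hx he
    refine (norm_mul_le _ _).trans (mul_le_mul ((norm_mul_le _ _).trans
      (mul_le_mul (hd x hx) he (norm_nonneg _) hd0)) (hc x hx) (norm_nonneg _) ?_)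
    exact mul_nonneg hd0 ((norm_nonneg _).trans he)
  have hKη : 0 ≤ K * η := (norm_nonneg _).trans (hEb 0 h0)
  have hη2 : K * η ^ 2 ≤ K * η := by nlinarith
  let B : ℝ → R := fun x => Z₀ x * (A x - A₀ x) * U₀ x
  let W : ℝ → R := fun x => Z₀ x * U x
  have hBc : Continuous B := (hZc.mul (hA.sub hA₀)).mul hUc
  have hW : ∀ x, HasDerivAt W (B x * W x) x := by
    intro x
    refine ((hZ₀ x).mul (hU x)).congr_deriv ?_
    have : B x * W x = Z₀ x * (A x - A₀ x) * (U₀ x * Z₀ x) * U x := by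
      simp only [B, W, mul_assoc]
    rw [this, hUZ]
    noncomm_ring
  have hBb : ∀ x ∈ Icc (0 : ℝ) 1, ‖B x‖ ≤ 2 * (d * K * c) * η := by
    intro x hx
    refine (hsand _ x (2 * (K * η)) hx ?_).trans (le_of_eq (by ring))
    calc ‖A x - A₀ x‖ = ‖(A x - A₀ x - E x) + E x‖ := by rw [sub_add_cancel]
      _ ≤ K * η + K * η := (norm_add_le _ _).trans (add_le_add ((hRb x hx).trans hη2) (hEb x hx))
      _ = _ := by ring
  have hbK : 2 * (d * K * c) * η ≤ 2 * (d * K * c) :=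
    mul_le_of_le_one_right (by positivity) hη1
  have key := norm_sub_one_sub_integral_le hBc (by simp [W, hZ₀0, hU0]) hW hbK hBb
  have hsplit : ∫ x in (0 : ℝ)..1, B x = (∫ x in (0 : ℝ)..1, Z₀ x * E x * U₀ x) +
      ∫ x in (0 : ℝ)..1, Z₀ x * (A x - A₀ x - E x) * U₀ x := by
    refine Eq.trans ?_ (intervalIntegral.integral_add
      (((hZc.mul hE).mul hUc).intervalIntegrable _ _)
      (((hZc.mul ((hA.sub hA₀).sub hE)).mul hUc).intervalIntegrable _ _))
    refine intervalIntegral.integral_congr fun x _ => ?_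
    change B x = Z₀ x * E x * U₀ x + Z₀ x * (A x - A₀ x - E x) * U₀ x
    simp only [B]
    noncomm_ring
  have hrem : ‖∫ x in (0 : ℝ)..1, Z₀ x * (A x - A₀ x - E x) * U₀ x‖ ≤ d * (K * η ^ 2) * c := by
    refine (intervalIntegral.norm_integral_le_of_norm_le_const ?_).trans
      (le_of_eq (by rw [sub_zero, abs_one, mul_one]))
    intro t ht
    rw [uIoc_of_le zero_le_one] at ht
    have ht' : t ∈ Icc (0 : ℝ) 1 := ⟨ht.1.le, ht.2⟩
    exact hsand _ t _ ht' (hRb t ht')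
  have hU1 : U 1 = U₀ 1 * W 1 := by simp only [W, ← mul_assoc, hUZ, one_mul]
  have : U 1 - U₀ 1 * (1 + ∫ x in (0 : ℝ)..1, Z₀ x * E x * U₀ x) =
      U₀ 1 * ((W 1 - 1 - ∫ x in (0 : ℝ)..1, B x) +
        ∫ x in (0 : ℝ)..1, Z₀ x * (A x - A₀ x - E x) * U₀ x) := by
    rw [hU1, hsplit]
    noncomm_ring
  rw [this]
  calc _ ≤ c * (‖(1 : R)‖ * Real.exp (2 * (d * K * c)) * (2 * (d * K * c) * η) ^ 2 +
        d * (K * η ^ 2) * c) :=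
        (norm_mul_le _ _).trans (mul_le_mul (hc 1 ⟨zero_le_one, le_rfl⟩)
          ((norm_add_le _ _).trans (add_le_add key hrem)) (norm_nonneg _) hc0)
    _ = _ := by ring

theorem IsSolutionOperator.continuous {n : Type*} [Fintype n] [DecidableEq n]
    {A U : ℝ → Matrix n n ℂ} (hU : IsSolutionOperator A U) : Continuous U :=
  continuous_pi fun i => continuous_pi fun j =>
    continuous_iff_continuousAt.2 fun x => (hU.2 x i j).continuousAt

/-- First order expansion of the monodromy matrix, entry by entry. -/
theorem exists_norm_monodromy_sub_le {n : Type*} [Fintype n] [DecidableEq n]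
    {A₀ U₀ Z₀ : ℝ → Matrix n n ℂ} (hU₀ : IsSolutionOperator A₀ U₀) (hZ₀0 : Z₀ 0 = 1)
    (hZ₀ : ∀ x i j, HasDerivAt (fun y => Z₀ y i j) ((-(Z₀ x * A₀ x)) i j) x)
    (hUZ : ∀ x, U₀ x * Z₀ x = 1) (hA₀ : Continuous A₀) {K : ℝ} (hK : 0 ≤ K) :
    ∃ C : ℝ, ∀ (A E : ℝ → Matrix n n ℂ) (η : ℝ), Continuous A → Continuous E →
      0 ≤ η → η ≤ 1 →
      (∀ x ∈ Icc (0 : ℝ) 1, ∀ i j, ‖E x i j‖ ≤ K * η) →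
      (∀ x ∈ Icc (0 : ℝ) 1, ∀ i j, ‖A x i j - A₀ x i j - E x i j‖ ≤ K * η ^ 2) →
      ∀ i j, ‖(monodromy A - U₀ 1 * (1 + Matrix.of fun k l =>
        ∫ x in (0 : ℝ)..1, (Z₀ x * E x * U₀ x) k l)) i j‖ ≤ C * η ^ 2 := by
  let _ : NormedRing (Matrix n n ℂ) := Matrix.linftyOpNormedRing
  let _ : NormedAlgebra ℝ (Matrix n n ℂ) := Matrix.linftyOpNormedAlgebra
  have _ : CompleteSpace (Matrix n n ℂ) := FiniteDimensional.complete ℝ _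
  have hd : ∀ {Z D : ℝ → Matrix n n ℂ}, (∀ x i j, HasDerivAt (fun y => Z y i j) (D x i j) x) →
      ∀ x, HasDerivAt Z (D x) x := fun h x =>
    hasDerivAt_pi.2 fun i => hasDerivAt_pi.2 fun j => h x i j
  have hentry : ∀ (F : Matrix n n ℂ) i j, ‖F i j‖ ≤ ‖F‖ := by
    intro F i j
    rw [Matrix.linfty_opNorm_def]
    have h1 : ‖F i j‖₊ ≤ ∑ j, ‖F i j‖₊ :=
      Finset.single_le_sum (f := fun j => ‖F i j‖₊) (fun _ _ => zero_le) (Finset.mem_univ j)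
    exact h1.trans (Finset.le_sup (f := fun i => ∑ j, ‖F i j‖₊) (Finset.mem_univ i))
  have hnorm : ∀ (F : Matrix n n ℂ) (e : ℝ), 0 ≤ e → (∀ i j, ‖F i j‖ ≤ e) →
      ‖F‖ ≤ Fintype.card n * e := by
    intro F e he h
    lift e to NNReal using he
    rw [Matrix.linfty_opNorm_def]
    have : (Finset.univ.sup fun i => ∑ j, ‖F i j‖₊) ≤ (Fintype.card n : NNReal) * e := by
      refine Finset.sup_le fun i _ => ?_
      refine (Finset.sum_le_sum fun j _ => show ‖F i j‖₊ ≤ e from h i j).trans (le_of_eq ?_)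
      simp
    exact_mod_cast this
  have hUc := hU₀.continuous
  have hZc : Continuous Z₀ := continuous_iff_continuousAt.2 fun x => (hd hZ₀ x).continuousAt
  obtain ⟨C, hC⟩ := exists_norm_solution_sub_le (hd hU₀.2) hZ₀0 (hd hZ₀) hUZ hA₀
    (K := Fintype.card n * K) (by positivity)
  refine ⟨C, fun A E η hA hE hη hη1 hEb hRb i j => ?_⟩
  obtain ⟨U, hU⟩ := exists_isSolutionOperator hA
  rw [monodromy_eq hA hU]
  have hint : (Matrix.of fun k l => ∫ x in (0 : ℝ)..1, (Z₀ x * E x * U₀ x) k l) =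
      ∫ x in (0 : ℝ)..1, Z₀ x * E x * U₀ x := by
    ext k l
    let L : Matrix n n ℂ →L[ℝ] ℂ := LinearMap.toContinuousLinearMap
      { toFun := fun M => M k l, map_add' := fun _ _ => rfl, map_smul' := fun _ _ => rfl }
    exact L.intervalIntegral_comp_comm
      (((hZc.mul hE).mul hUc).intervalIntegrable (μ := MeasureTheory.volume) 0 1)
  rw [hint]
  refine (hentry _ i j).trans (hC A U E η hA hE hU.1 (hd hU.2) hη hη1 ?_ ?_)
  · intro x hx
    exact (hnorm _ _ (by positivity) (hEb x hx)).trans (le_of_eq (by ring))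
  · intro x hx
    exact (hnorm _ _ (by positivity) (hRb x hx)).trans (le_of_eq (by ring))

end Perturbation

/-! ### Hill's equation -/

section Hill

open Matrix

theorem hasDerivAt_of_isSolutionOperator_hill {V : ℝ → ℝ} {ω₀ : ℝ} {μ : ℂ}
    {U : ℝ → Matrix (Fin 2) (Fin 2) ℂ} (hU : IsSolutionOperator (hillMatrix V ω₀ μ) U) (x : ℝ)
    (j : Fin 2) :
    HasDerivAt (fun y => U y 0 j) (U x 1 j) x ∧
      HasDerivAt (fun y => U y 1 j) (2 * ((V x : ℂ) - ω₀ - μ) * U x 0 j) x := by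
  have h0 := hU.2 x 0 j
  have h1 := hU.2 x 1 j
  simp only [hillMatrix, Matrix.mul_apply, Fin.sum_univ_two] at h0 h1
  exact ⟨h0.congr_deriv (by simp), h1.congr_deriv (by simp)⟩

/-- Liouville's formula for Hill's equation: the Wronskian is constant. -/
theorem det_eq_one_of_isSolutionOperator_hill {V : ℝ → ℝ} {ω₀ : ℝ} {μ : ℂ}
    {U : ℝ → Matrix (Fin 2) (Fin 2) ℂ} (hU : IsSolutionOperator (hillMatrix V ω₀ μ) U) (x : ℝ) :
    (U x).det = 1 := by
  have h : ∀ y, HasDerivAt (fun z => (U z).det) 0 y := by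
    intro y
    simp only [det_fin_two]
    have d := hasDerivAt_of_isSolutionOperator_hill hU y
    refine (((d 0).1.mul (d 1).2).sub ((d 1).1.mul (d 0).2)).congr_deriv ?_
    ring
  have := is_const_of_deriv_eq_zero (fun y => (h y).differentiableAt) (fun y => (h y).deriv) x 0
  rw [this, hU.1, det_one]

theorem continuous_hillMatrix {V : ℝ → ℝ} (hV : Continuous V) (ω₀ : ℝ) (μ : ℂ) :
    Continuous (hillMatrix V ω₀ μ) := by
  refine continuous_pi fun i => continuous_pi fun j => ?_
  fin_cases i <;> fin_cases j <;> simp [hillMatrix] <;> fun_prop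

/-- For a real spectral parameter the solution operator of Hill's equation can be taken real. -/
theorem exists_hill_solution {V : ℝ → ℝ} (hV : Continuous V) (ω₀ : ℝ) (μ : ℂ) :
    ∃ U, IsSolutionOperator (hillMatrix V ω₀ μ) U ∧
      (μ.im = 0 → ∀ x i j, (U x i j).im = 0) := by
  obtain ⟨U, hU⟩ := exists_isSolutionOperator (continuous_hillMatrix hV ω₀ μ)
  by_cases hμ : μ.im = 0
  swap
  · exact ⟨U, hU, fun h => absurd h hμ⟩
  -- the entrywise real part of a solution of a real system is again a solution
  refine ⟨fun x => (U x).map fun z => ((z.re : ℝ) : ℂ), ⟨?_, fun x i j => ?_⟩, fun _ x i j => ?_⟩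
  · ext i j
    by_cases h : i = j <;> simp [hU.1, Matrix.one_apply, h]
  · have h2 : HasDerivAt (fun y => (U y i j).re) ((hillMatrix V ω₀ μ x * U x) i j).re x :=
      (Complex.reCLM.hasFDerivAt.comp_hasDerivAt x (hU.2 x i j))
    have h3 := h2.ofReal_comp
    refine h3.congr_deriv ?_
    have hμ' : μ = (μ.re : ℂ) := Complex.ext rfl (by simp [hμ])
    rw [hμ']
    fin_cases i <;> simp [hillMatrix, Matrix.mul_apply, Fin.sum_univ_two]
  · simp

/-- The matrix of `f(x) E₂₁`, conjugated by `U₁(x)⁻¹` on the left and `U₂(x)` on the right and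
integrated over a period: the first order effect of a perturbation of the potential. The inverse
of the unimodular matrix `U₁(x)` is its adjugate. -/
noncomputable def overlapMatrix (U₁ U₂ : ℝ → Matrix (Fin 2) (Fin 2) ℂ) (f : ℝ → ℂ) :
    Matrix (Fin 2) (Fin 2) ℂ :=
  Matrix.of fun i j =>
    ∫ x in (0 : ℝ)..1, f x * ((U₁ x).adjugate * !![0, 0; 1, 0] * U₂ x : Matrix (Fin 2) (Fin 2) ℂ) i j

theorem adjugate_mul_mul_eq (A B : Matrix (Fin 2) (Fin 2) ℂ) :
    A.adjugate * !![0, 0; 1, 0] * B =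
      !![-(A 0 1 * B 0 0), -(A 0 1 * B 0 1); A 0 0 * B 0 0, A 0 0 * B 0 1] := by
  rw [adjugate_fin_two]
  ext i j
  fin_cases i <;> fin_cases j <;> simp [Matrix.mul_apply, Fin.sum_univ_two]

theorem overlapMatrix_eq (U₁ U₂ : ℝ → Matrix (Fin 2) (Fin 2) ℂ) (f : ℝ → ℂ) :
    overlapMatrix U₁ U₂ f =
      !![-∫ x in (0 : ℝ)..1, f x * (U₁ x 0 1 * U₂ x 0 0),
          -∫ x in (0 : ℝ)..1, f x * (U₁ x 0 1 * U₂ x 0 1);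
        ∫ x in (0 : ℝ)..1, f x * (U₁ x 0 0 * U₂ x 0 0),
          ∫ x in (0 : ℝ)..1, f x * (U₁ x 0 0 * U₂ x 0 1)] := by
  ext i j
  simp only [overlapMatrix, Matrix.of_apply, adjugate_mul_mul_eq]
  fin_cases i <;> fin_cases j <;> simp

theorem adjugate_overlapMatrix (U₁ U₂ : ℝ → Matrix (Fin 2) (Fin 2) ℂ) (f : ℝ → ℂ) :
    (overlapMatrix U₂ U₁ f).adjugate = -overlapMatrix U₁ U₂ f := by
  simp only [overlapMatrix_eq, adjugate_fin_two, mul_comm (U₂ _ 0 _)]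
  ext i j
  fin_cases i <;> fin_cases j <;> simp

theorem im_overlapMatrix {U₁ U₂ : ℝ → Matrix (Fin 2) (Fin 2) ℂ} {f : ℝ → ℂ}
    (h₁ : ∀ x i j, (U₁ x i j).im = 0) (h₂ : ∀ x i j, (U₂ x i j).im = 0)
    (hf : ∀ x, (f x).im = 0) (i j : Fin 2) : (overlapMatrix U₁ U₂ f i j).im = 0 := by
  have key : ∀ g : ℝ → ℂ, (∀ x, (g x).im = 0) → (∫ x in (0 : ℝ)..1, g x).im = 0 := by
    intro g hg
    have : ∀ x, g x = (((g x).re : ℝ) : ℂ) := fun x => Complex.ext rfl (by simp [hg])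
    rw [intervalIntegral.integral_congr (g := fun x => (((g x).re : ℝ) : ℂ)) fun x _ => this x,
      intervalIntegral.integral_ofReal]
    exact Complex.ofReal_im _
  rw [overlapMatrix_eq]
  fin_cases i <;> fin_cases j <;> simp <;>
    exact key _ fun x => by simp [Complex.mul_im, h₁, h₂, hf]

/-- Entries of the inverse of a solution operator of Hill's equation solve the adjoint system. -/
theorem hasDerivAt_adjugate_hill {V : ℝ → ℝ} {ω₀ : ℝ} {μ : ℂ}
    {U : ℝ → Matrix (Fin 2) (Fin 2) ℂ} (hU : IsSolutionOperator (hillMatrix V ω₀ μ) U) (x : ℝ)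
    (i j : Fin 2) :
    HasDerivAt (fun y => (U y).adjugate i j) ((-((U x).adjugate * hillMatrix V ω₀ μ x)) i j) x := by
  have d := hasDerivAt_of_isSolutionOperator_hill hU x
  simp only [adjugate_fin_two, hillMatrix, Matrix.neg_apply, Matrix.mul_apply, Fin.sum_univ_two]
  fin_cases i <;> fin_cases j
  · exact (d 1).2.congr_deriv (by simp; ring)
  · exact (d 1).1.neg.congr_deriv (by simp)
  · exact (d 0).2.neg.congr_deriv (by simp; ring)
  · exact (d 0).1.congr_deriv (by simp)

/-- The derivative of the discriminant is `-2 Tr (m ∫ U⁻¹ E₂₁ U)`. -/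
theorem hasDerivAt_hillDiscriminant {V : ℝ → ℝ} (hV : Continuous V) {ω₀ : ℝ} {μ : ℂ}
    {U : ℝ → Matrix (Fin 2) (Fin 2) ℂ} (hU : IsSolutionOperator (hillMatrix V ω₀ μ) U) :
    HasDerivAt (hillDiscriminant V ω₀) (-2 * (U 1 * overlapMatrix U U 1).trace) μ := by
  have hinv : ∀ x, U x * (U x).adjugate = 1 := fun x => by
    rw [mul_adjugate, det_eq_one_of_isSolutionOperator_hill hU, one_smul]
  obtain ⟨C, hC⟩ := exists_norm_monodromy_sub_le hU (Z₀ := fun x => (U x).adjugate)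
    (by simp [hU.1]) (hasDerivAt_adjugate_hill hU) hinv (continuous_hillMatrix hV ω₀ μ)
    (K := 2) (by norm_num)
  have hbound : ∀ ν : ℂ, ‖ν - μ‖ ≤ 1 → ‖hillDiscriminant V ω₀ ν - hillDiscriminant V ω₀ μ -
      (ν - μ) * (-2 * (U 1 * overlapMatrix U U 1).trace)‖ ≤ 2 * C * ‖ν - μ‖ ^ 2 := by
    intro ν hν
    have h := hC (hillMatrix V ω₀ ν) (fun _ => (-2 * (ν - μ)) • !![0, 0; 1, 0]) ‖ν - μ‖
      (continuous_hillMatrix hV ω₀ ν) continuous_const (norm_nonneg _) hν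
      (fun x _ i j => by fin_cases i <;> fin_cases j <;> simp)
      (fun x _ i j => by
        have : hillMatrix V ω₀ ν x i j - hillMatrix V ω₀ μ x i j -
            ((-2 * (ν - μ)) • !![0, 0; 1, 0] : Matrix (Fin 2) (Fin 2) ℂ) i j = 0 := by
          fin_cases i <;> fin_cases j <;> simp [hillMatrix]
          ring
        rw [this, norm_zero]
        positivity)
    have hof : (Matrix.of fun k l => ∫ x in (0 : ℝ)..1, ((U x).adjugate *
        ((-2 * (ν - μ)) • !![0, 0; 1, 0]) * U x : Matrix (Fin 2) (Fin 2) ℂ) k l) =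
        (-2 * (ν - μ)) • overlapMatrix U U 1 := by
      ext i j
      simp only [Matrix.mul_smul, Matrix.smul_mul, Matrix.smul_apply, Matrix.of_apply,
        smul_eq_mul, overlapMatrix, Pi.one_apply, one_mul]
      exact intervalIntegral.integral_const_mul _ _
    simp only [hof] at h
    have e : hillDiscriminant V ω₀ ν - hillDiscriminant V ω₀ μ -
        (ν - μ) * (-2 * (U 1 * overlapMatrix U U 1).trace) =
        (monodromy (hillMatrix V ω₀ ν) - U 1 * (1 + (-2 * (ν - μ)) • overlapMatrix U U 1)).trace := by
      rw [hillDiscriminant, hillDiscriminant, monodromy_eq (continuous_hillMatrix hV ω₀ μ) hU,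
        trace_sub, mul_add, trace_add, mul_one, Matrix.mul_smul, trace_smul, smul_eq_mul]
      ring
    rw [e, trace_fin_two]
    refine (norm_add_le _ _).trans ((add_le_add (h 0 0) (h 1 1)).trans (le_of_eq (by ring)))
  have hO : (fun ν => hillDiscriminant V ω₀ ν - hillDiscriminant V ω₀ μ -
      (ν - μ) * (-2 * (U 1 * overlapMatrix U U 1).trace)) =O[nhds μ] fun ν => ‖ν - μ‖ ^ 2 := by
    refine Asymptotics.IsBigO.of_bound (2 * C) ?_
    filter_upwards [Metric.ball_mem_nhds μ one_pos] with ν hν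
    rw [Metric.mem_ball, dist_eq_norm] at hν
    simpa using hbound ν hν.le
  have hD := (hO.hasFDerivAt one_lt_two).hasDerivAt
  have hL : HasDerivAt (fun ν => (ν - μ) * (-2 * (U 1 * overlapMatrix U U 1).trace))
      (1 * (-2 * (U 1 * overlapMatrix U U 1).trace)) μ :=
    ((hasDerivAt_id μ).sub_const μ).mul_const _
  have := (hD.add hL).add_const (hillDiscriminant V ω₀ μ)
  refine (this.congr_of_eventuallyEq (.of_forall fun ν => ?_)).congr_deriv (by simp)
  simp

/-- Inside a spectral band, `k'` and the upper right entry of the (real) monodromy matrix have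
opposite signs. -/
theorem mul_deriv_hillDiscriminant_neg {V : ℝ → ℝ} (hV : Continuous V) {ω₀ : ℝ} {μ : ℂ}
    {U : ℝ → Matrix (Fin 2) (Fin 2) ℂ} (hU : IsSolutionOperator (hillMatrix V ω₀ μ) U)
    (hre : ∀ x i j, (U x i j).im = 0) (hk : (U 1).trace.re ^ 2 < 4) :
    (U 1 0 1).re * (deriv (hillDiscriminant V ω₀) μ).re < 0 := by
  rw [(hasDerivAt_hillDiscriminant hV hU).deriv]
  set u : ℝ → Matrix (Fin 2) (Fin 2) ℝ := fun x => (U x).map Complex.re with hu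
  have hUu : ∀ x i j, U x i j = (u x i j : ℂ) := fun x i j =>
    Complex.ext rfl (by simp [hre])
  have huc : ∀ i j, Continuous fun x => u x i j := fun i j =>
    Complex.continuous_re.comp ((continuous_apply j).comp
      ((continuous_apply i).comp hU.continuous))
  have hdet : u 1 0 0 * u 1 1 1 - u 1 0 1 * u 1 1 0 = 1 := by
    have := det_eq_one_of_isSolutionOperator_hill hU 1
    rw [det_fin_two] at this
    simp only [hUu] at this
    exact_mod_cast this
  have hk' : (u 1 0 0 + u 1 1 1) ^ 2 < 4 := by
    rw [trace_fin_two] at hk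
    simpa [hUu] using hk
  have i1 : IntervalIntegrable (fun x => u x 0 0 ^ 2) MeasureTheory.volume 0 1 :=
    ((huc 0 0).pow 2).intervalIntegrable _ _
  have i2 : IntervalIntegrable (fun x => u x 0 0 * u x 0 1) MeasureTheory.volume 0 1 :=
    ((huc 0 0).mul (huc 0 1)).intervalIntegrable _ _
  have i3 : IntervalIntegrable (fun x => u x 0 1 ^ 2) MeasureTheory.volume 0 1 :=
    ((huc 0 1).pow 2).intervalIntegrable _ _
  have hpos : 0 < ∫ x in (0 : ℝ)..1, (u 1 0 1 ^ 2 * u x 0 0 ^ 2 +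
      u 1 0 1 * (u 1 1 1 - u 1 0 0) * (u x 0 0 * u x 0 1) +
      (1 - u 1 0 0 * u 1 1 1) * u x 0 1 ^ 2) := by
    have hsq : ∀ x, u 1 0 1 ^ 2 * u x 0 0 ^ 2 +
        u 1 0 1 * (u 1 1 1 - u 1 0 0) * (u x 0 0 * u x 0 1) +
        (1 - u 1 0 0 * u 1 1 1) * u x 0 1 ^ 2 =
        (u 1 0 1 * u x 0 0 + (u 1 1 1 - u 1 0 0) / 2 * u x 0 1) ^ 2 +
          (4 - (u 1 0 0 + u 1 1 1) ^ 2) / 4 * u x 0 1 ^ 2 := fun x => by ring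
    refine intervalIntegral.integral_pos one_pos ?_ (fun x _ => ?_) ⟨0, ⟨le_rfl, zero_le_one⟩, ?_⟩
    · have := huc 0 0
      have := huc 0 1
      exact Continuous.continuousOn (by fun_prop)
    · rw [hsq]
      have : 0 ≤ (4 - (u 1 0 0 + u 1 1 1) ^ 2) / 4 := by linarith
      positivity
    · have h0 : u 0 0 0 = 1 ∧ u 0 0 1 = 0 := by simp [hu, hU.1]
      rw [h0.1, h0.2]
      have : u 1 0 1 ≠ 0 := by
        intro h
        rw [h] at hdet
        nlinarith [sq_nonneg (u 1 0 0 - u 1 1 1)]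
      have := sq_pos_of_ne_zero this
      linarith
  rw [intervalIntegral.integral_add ((i1.const_mul _).add (i2.const_mul _)) (i3.const_mul _),
    intervalIntegral.integral_add (i1.const_mul _) (i2.const_mul _),
    intervalIntegral.integral_const_mul, intervalIntegral.integral_const_mul,
    intervalIntegral.integral_const_mul] at hpos
  have hov : overlapMatrix U U 1 = !![((-∫ x in (0 : ℝ)..1, u x 0 0 * u x 0 1 : ℝ) : ℂ),
      ((-∫ x in (0 : ℝ)..1, u x 0 1 ^ 2 : ℝ) : ℂ);
      ((∫ x in (0 : ℝ)..1, u x 0 0 ^ 2 : ℝ) : ℂ),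
      ((∫ x in (0 : ℝ)..1, u x 0 0 * u x 0 1 : ℝ) : ℂ)] := by
    simp only [overlapMatrix_eq, hUu, Complex.ofReal_neg, ← intervalIntegral.integral_ofReal,
      Pi.one_apply, one_mul, Complex.ofReal_mul, sq,
      mul_comm ((u _ 0 1 : ℝ) : ℂ) ((u _ 0 0 : ℝ) : ℂ)]
  rw [hov, trace_fin_two]
  simp only [Matrix.mul_apply, Fin.sum_univ_two, hUu, Matrix.of_apply, Matrix.cons_val',
    Matrix.cons_val_zero, Matrix.cons_val_one, Matrix.cons_val_fin_one]
  generalize (∫ x in (0 : ℝ)..1, u x 0 0 ^ 2) = X at *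
  generalize (∫ x in (0 : ℝ)..1, u x 0 0 * u x 0 1) = Y at *
  generalize (∫ x in (0 : ℝ)..1, u x 0 1 ^ 2) = Z at *
  norm_cast
  push_cast
  have hd : 1 - u 1 0 0 * u 1 1 1 = - (u 1 0 1 * u 1 1 0) := by linarith
  rw [hd] at hpos
  simp
  nlinarith

end Hill

/-! ### Expansion of the standing waves -/

section StandingWaveExpansion

/-- The profiles depend Lipschitz continuously on `ε` at `ε = 0`, uniformly over a period. -/
theorem IsStandingWaveFamily.exists_abs_sub_le {V : ℝ → ℝ} {δ : ℝ} {φ : ℝ → ℝ → ℝ} {ω : ℝ → ℝ}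
    (h : IsStandingWaveFamily V δ φ ω) :
    ∃ C : ℝ, 0 ≤ C ∧ ∀ x ∈ Icc (0 : ℝ) 1, ∀ ε : ℝ, |ε| ≤ δ / 2 →
      |φ x ε| ≤ C ∧ |φ x ε - φ x 0| ≤ C * |ε| := by
  have hδ := h.pos
  set f : ℝ × ℝ → ℝ := fun p => φ p.1 p.2
  set S : Set (ℝ × ℝ) := univ ×ˢ Ioo (-δ) δ
  set T : Set (ℝ × ℝ) := Icc (0 : ℝ) 1 ×ˢ Icc (-(δ / 2)) (δ / 2)
  have hS : IsOpen S := isOpen_univ.prod isOpen_Ioo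
  have hTS : T ⊆ S := fun p hp => ⟨mem_univ _, by linarith [hp.2.1], by linarith [hp.2.2]⟩
  have hT : IsCompact T := isCompact_Icc.prod isCompact_Icc
  have hTc : Convex ℝ T := (convex_Icc _ _).prod (convex_Icc _ _)
  obtain ⟨C₁, hC₁⟩ := hT.exists_bound_of_continuousOn (h.contDiffOn.continuousOn.mono hTS)
  obtain ⟨C₂, hC₂⟩ := hT.exists_bound_of_continuousOn
    ((h.contDiffOn.continuousOn_fderiv_of_isOpen hS (by norm_num)).mono hTS)
  have hlip := fun p hp q hq => hTc.norm_image_sub_le_of_norm_fderiv_le (𝕜 := ℝ) (f := f)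
    (x := p) (y := q) (C := C₂)
    (fun z hz => (h.contDiffOn.contDiffAt (hS.mem_nhds (hTS hz))).differentiableAt (by norm_num))
    hC₂ hp hq
  refine ⟨max C₁ C₂, ?_, fun x hx ε hε => ?_⟩
  · exact (norm_nonneg _).trans ((hC₁ (0, 0) ⟨by simp, by constructor <;> simp <;> linarith⟩).trans
      (le_max_left _ _))
  have hε' := abs_le.1 hε
  have h0 : ((x, 0) : ℝ × ℝ) ∈ T := ⟨hx, by constructor <;> simp <;> linarith⟩
  have h1 : ((x, ε) : ℝ × ℝ) ∈ T := ⟨hx, hε'⟩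
  refine ⟨(hC₁ _ h1).trans (le_max_left _ _), (hlip _ h0 _ h1).trans ?_⟩
  have : ‖((x, ε) : ℝ × ℝ) - (x, 0)‖ = |ε| := by simp [Prod.norm_def]
  rw [this]
  gcongr
  exact le_max_right _ _

theorem IsStandingWaveFamily.contDiff {V : ℝ → ℝ} {δ : ℝ} {φ : ℝ → ℝ → ℝ} {ω : ℝ → ℝ}
    (h : IsStandingWaveFamily V δ φ ω) {ε : ℝ} (hε : ε ∈ Ioo (-δ) δ) :
    ContDiff ℝ 2 fun x => φ x ε := by
  rw [← contDiffOn_univ]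
  exact h.contDiffOn.comp (g := fun p : ℝ × ℝ => φ p.1 p.2) (f := fun x : ℝ => (x, ε))
    (s := univ) (contDiff_id.prodMk contDiff_const).contDiffOn (fun x _ => ⟨mem_univ _, hε⟩)

theorem IsStandingWaveFamily.integral_sq_pos {V : ℝ → ℝ} {δ : ℝ} {φ : ℝ → ℝ → ℝ} {ω : ℝ → ℝ}
    (h : IsStandingWaveFamily V δ φ ω) : 0 < ∫ x in (0 : ℝ)..1, φ x 0 * φ x 0 := by
  have h0 : (0 : ℝ) ∈ Ioo (-δ) δ := ⟨by linarith [h.pos], h.pos⟩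
  have hc : Continuous fun x => φ x 0 := (h.contDiff h0).continuous
  have hper : Function.Periodic (fun x => φ x 0 * φ x 0) 1 := by
    intro x
    rcases h.periodic_or_antiperiodic with hp | hp <;> simp [hp 0 h0 x]
  obtain ⟨x, hx⟩ := h.nontrivial
  obtain ⟨y, hy, hxy⟩ := hper.exists_mem_Ico₀ one_pos x
  refine intervalIntegral.integral_pos one_pos (hc.mul hc).continuousOn
    (fun x _ => mul_self_nonneg _) ⟨y, ⟨hy.1, hy.2.le⟩, ?_⟩
  rw [← hxy]
  exact mul_self_pos.2 hx

/-- Solvability condition: pairing the equations for `φ(·, ε)` and `φ(·, 0)` over a period. -/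
theorem IsStandingWaveFamily.frequency_mul_integral {V : ℝ → ℝ} {δ : ℝ} {φ : ℝ → ℝ → ℝ}
    {ω : ℝ → ℝ} (h : IsStandingWaveFamily V δ φ ω) {ε : ℝ} (hε : ε ∈ Ioo (-δ) δ) :
    (ω ε - ω 0) * (∫ x in (0 : ℝ)..1, φ x ε * φ x 0) =
      ε * ∫ x in (0 : ℝ)..1, φ x ε ^ 3 * φ x 0 := by
  have h0 : (0 : ℝ) ∈ Ioo (-δ) δ := ⟨by linarith [h.pos], h.pos⟩
  have hcd : ∀ e ∈ Ioo (-δ) δ, Differentiable ℝ (fun x => φ x e) ∧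
      Differentiable ℝ (deriv fun x => φ x e) ∧ Continuous fun x => φ x e := fun e he =>
    ⟨(h.contDiff he).differentiable (by norm_num),
      (h.contDiff he).differentiable_deriv_two, (h.contDiff he).continuous⟩
  obtain ⟨hd1, hdd1, hc1⟩ := hcd ε hε
  obtain ⟨hd0, hdd0, hc0⟩ := hcd 0 h0
  -- the Wronskian of the two profiles is periodic
  let w : ℝ → ℝ := fun x => deriv (fun y => φ y ε) x * φ x 0 - φ x ε * deriv (fun y => φ y 0) x
  have hw : ∀ x, HasDerivAt w
      (2 * (ε * (φ x ε ^ 3 * φ x 0) - (ω ε - ω 0) * (φ x ε * φ x 0))) x := by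
    intro x
    have := ((hdd1 x).hasDerivAt.mul (hd0 x).hasDerivAt).sub
      ((hd1 x).hasDerivAt.mul (hdd0 x).hasDerivAt)
    refine this.congr_deriv ?_
    have e1 := h.equation ε hε x
    have e0 := h.equation 0 h0 x
    rw [sq_abs] at e1 e0
    linear_combination (-2 * φ x 0) * e1 + 2 * φ x ε * e0
  have hwper : w 1 = w 0 := by
    have hshift : ∀ e ∈ Ioo (-δ) δ, ∀ σ : ℝ, (∀ x, φ (x + 1) e = σ * φ x e) →
        φ 1 e = σ * φ 0 e ∧ deriv (fun y => φ y e) 1 = σ * deriv (fun y => φ y e) 0 := by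
      intro e he σ hσ
      have h1 := (hcd e he).1
      refine ⟨by simpa using hσ 0, ?_⟩
      have : deriv (fun y => φ (y + 1) e) 0 = deriv (fun y => φ y e) (0 + 1) :=
        deriv_comp_add_const (fun y => φ y e) 1 0
      rw [zero_add] at this
      rw [← this]
      simp_rw [hσ]
      exact deriv_const_mul _ (h1 0)
    rcases h.periodic_or_antiperiodic with hp | hp
    · have a1 := hshift ε hε 1 (by simpa using hp ε hε)
      have a0 := hshift 0 h0 1 (by simpa using hp 0 h0)
      simp only [w, a1.1, a1.2, a0.1, a0.2]
      ring
    · have a1 := hshift ε hε (-1) (by simpa using hp ε hε)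
      have a0 := hshift 0 h0 (-1) (by simpa using hp 0 h0)
      simp only [w, a1.1, a1.2, a0.1, a0.2]
      ring
  have i1 : IntervalIntegrable (fun x => φ x ε ^ 3 * φ x 0) MeasureTheory.volume 0 1 :=
    ((hc1.pow 3).mul hc0).intervalIntegrable _ _
  have i2 : IntervalIntegrable (fun x => φ x ε * φ x 0) MeasureTheory.volume 0 1 :=
    (hc1.mul hc0).intervalIntegrable _ _
  have := intervalIntegral.integral_eq_sub_of_hasDerivAt (a := 0) (b := 1) (fun x _ => hw x)
    (((i1.const_mul ε).sub (i2.const_mul _)).const_mul 2)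
  rw [hwper, sub_self, intervalIntegral.integral_const_mul,
    intervalIntegral.integral_sub (i1.const_mul ε) (i2.const_mul _),
    intervalIntegral.integral_const_mul, intervalIntegral.integral_const_mul] at this
  linarith

/-- The frequency is differentiable at `ε = 0` with a quadratic remainder. -/
theorem IsStandingWaveFamily.exists_frequency_expansion {V : ℝ → ℝ} {δ : ℝ} {φ : ℝ → ℝ → ℝ}
    {ω : ℝ → ℝ} (h : IsStandingWaveFamily V δ φ ω) :
    ∃ ω₁ C r : ℝ, 0 < r ∧ r ≤ δ / 2 ∧ ∀ ε : ℝ, |ε| ≤ r →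
      |ω ε - ω 0 - ω₁ * ε| ≤ C * |ε| ^ 2 := by
  have hδ := h.pos
  have h0 : (0 : ℝ) ∈ Ioo (-δ) δ := ⟨by linarith, hδ⟩
  obtain ⟨C, hC0, hC⟩ := h.exists_abs_sub_le
  have hc0 : Continuous fun x => φ x 0 := (h.contDiff h0).continuous
  have hdiff : ∀ F : ℝ → ℝ, Continuous F → ∀ D : ℝ,
      (∀ a b : ℝ, |a| ≤ C → |b| ≤ C → |F a - F b| ≤ D * |a - b|) → 0 ≤ D →
      ∀ ε : ℝ, |ε| ≤ δ / 2 →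
      |(∫ x in (0 : ℝ)..1, F (φ x ε) * φ x 0) - ∫ x in (0 : ℝ)..1, F (φ x 0) * φ x 0| ≤
        D * C * C * |ε| := by
    intro F hF D hD hD0 ε hε
    have hε' : ε ∈ Ioo (-δ) δ := by
      have := abs_le.1 hε
      exact ⟨by linarith, by linarith⟩
    have hc1 : Continuous fun x => φ x ε := (h.contDiff hε').continuous
    have g1 : Continuous fun x => F (φ x ε) * φ x 0 := (hF.comp hc1).mul hc0
    have g0 : Continuous fun x => F (φ x 0) * φ x 0 := (hF.comp hc0).mul hc0
    rw [← intervalIntegral.integral_sub (g1.intervalIntegrable _ _)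
      (g0.intervalIntegrable _ _), ← Real.norm_eq_abs]
    refine (intervalIntegral.norm_integral_le_of_norm_le_const
      (C := D * C * C * |ε|) fun x hx => ?_).trans (le_of_eq (by simp))
    rw [uIoc_of_le zero_le_one] at hx
    have hx' : x ∈ Icc (0 : ℝ) 1 := ⟨hx.1.le, hx.2⟩
    obtain ⟨b1, b2⟩ := hC x hx' ε hε
    obtain ⟨b3, -⟩ := hC x hx' 0 (by simp; linarith)
    rw [← sub_mul, Real.norm_eq_abs, abs_mul]
    calc _ ≤ (D * (C * |ε|)) * C :=
          mul_le_mul ((hD _ _ b1 b3).trans (mul_le_mul_of_nonneg_left b2 hD0)) b3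
            (abs_nonneg _) (by positivity)
      _ = _ := by ring
  set I : ℝ → ℝ := fun ε => ∫ x in (0 : ℝ)..1, φ x ε * φ x 0 with hI
  set Z : ℝ → ℝ := fun ε => ∫ x in (0 : ℝ)..1, φ x ε ^ 3 * φ x 0 with hZ
  have hIb : ∀ ε : ℝ, |ε| ≤ δ / 2 → |I ε - I 0| ≤ 1 * C * C * |ε| :=
    hdiff id continuous_id 1 (fun a b _ _ => by simp) zero_le_one
  have hZb : ∀ ε : ℝ, |ε| ≤ δ / 2 → |Z ε - Z 0| ≤ (3 * C ^ 2) * C * C * |ε| := by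
    refine hdiff (fun y => y ^ 3) (by fun_prop) (3 * C ^ 2) (fun a b ha hb => ?_) (by positivity)
    have : a ^ 3 - b ^ 3 = (a ^ 2 + a * b + b ^ 2) * (a - b) := by ring
    rw [this, abs_mul]
    gcongr
    have ha2 : |a ^ 2| ≤ C ^ 2 := by rw [abs_pow]; gcongr
    have hb2 : |b ^ 2| ≤ C ^ 2 := by rw [abs_pow]; gcongr
    have hab : |a * b| ≤ C * C := by rw [abs_mul]; gcongr
    have := abs_add_le (a ^ 2 + a * b) (b ^ 2)
    have := abs_add_le (a ^ 2) (a * b)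
    nlinarith
  have hIpos : 0 < I 0 := h.integral_sq_pos
  have hid : ∀ ε : ℝ, |ε| ≤ δ / 2 → (ω ε - ω 0) * I ε = ε * Z ε := by
    intro ε hε
    have := abs_le.1 hε
    exact h.frequency_mul_integral ⟨by linarith, by linarith⟩
  refine ⟨Z 0 / I 0, (3 * C ^ 2 * C * C + |Z 0 / I 0| * (C * C)) / (I 0 / 2),
    min (δ / 2) (I 0 / (2 * (C * C + 1))), ?_, min_le_left _ _, fun ε hε => ?_⟩
  · exact lt_min (by linarith) (by positivity)
  have hε1 := hε.trans (min_le_left _ _)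
  have hε2 := hε.trans (min_le_right _ _)
  rw [le_div_iff₀ (by positivity)] at hε2
  have hIε : I 0 / 2 ≤ I ε := by
    have := abs_le.1 (hIb ε hε1)
    have := abs_nonneg ε
    nlinarith
  have hkey : (ω ε - ω 0 - Z 0 / I 0 * ε) * I ε =
      ε * ((Z ε - Z 0) - Z 0 / I 0 * (I ε - I 0)) := by
    have := hid ε hε1
    have h2 : Z 0 / I 0 * I 0 = Z 0 := div_mul_cancel₀ _ hIpos.ne'
    linear_combination this - ε * h2
  rw [div_mul_eq_mul_div _ (I 0 / 2), le_div_iff₀ (by positivity)]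
  calc |ω ε - ω 0 - Z 0 / I 0 * ε| * (I 0 / 2)
      ≤ |ω ε - ω 0 - Z 0 / I 0 * ε| * |I ε| := by
        gcongr
        exact hIε.trans (le_abs_self _)
    _ = |ε| * |(Z ε - Z 0) - Z 0 / I 0 * (I ε - I 0)| := by rw [← abs_mul, hkey, abs_mul]
    _ ≤ |ε| * ((3 * C ^ 2) * C * C * |ε| + |Z 0 / I 0| * (1 * C * C * |ε|)) := by
        gcongr
        refine (abs_sub _ _).trans (add_le_add (hZb ε hε1) ?_)
        rw [abs_mul]
        gcongr
        exact hIb ε hε1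
    _ = _ := by ring

end StandingWaveExpansion

/-! ### The stability problem as a coupled pair of Hill equations -/

section BlockSystem

open Matrix

/-- The change of variables `(p, p', q, q') ↦ (p + q, p' + q', p - q, p' - q')`, which decouples
the stability problem at `ε = 0`. -/
def sumDiffMatrix : Matrix (Fin 2 ⊕ Fin 2) (Fin 4) ℂ :=
  fromRows !![1, 0, 1, 0; 0, 1, 0, 1] !![1, 0, -1, 0; 0, 1, 0, -1]

/-- The inverse of `sumDiffMatrix`. -/
noncomputable def sumDiffInvMatrix : Matrix (Fin 4) (Fin 2 ⊕ Fin 2) ℂ :=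
  fromCols !![1 / 2, 0; 0, 1 / 2; 1 / 2, 0; 0, 1 / 2] !![1 / 2, 0; 0, 1 / 2; -1 / 2, 0; 0, -1 / 2]

/-- The stability problem as a first order system for `(p + q, p' + q', p - q, p' - q')`: two
copies of Hill's equation, with parameters `μ` and `-μ`, coupled at order `ε`. -/
noncomputable def coupledHillMatrix (V : ℝ → ℝ) (φ : ℝ → ℝ → ℝ) (ω : ℝ → ℝ) (μ : ℂ) (ε : ℝ)
    (x : ℝ) : Matrix (Fin 2 ⊕ Fin 2) (Fin 2 ⊕ Fin 2) ℂ :=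
  fromBlocks
    (hillMatrix V (ω 0) μ x +
      (2 * (2 * ε * φ x ε ^ 2 - (ω ε - ω 0) : ℝ) : ℂ) • !![0, 0; 1, 0])
    ((2 * (ε * φ x ε ^ 2 : ℝ) : ℂ) • !![0, 0; 1, 0])
    ((2 * (ε * φ x ε ^ 2 : ℝ) : ℂ) • !![0, 0; 1, 0])
    (hillMatrix V (ω 0) (-μ) x +
      (2 * (2 * ε * φ x ε ^ 2 - (ω ε - ω 0) : ℝ) : ℂ) • !![0, 0; 1, 0])

theorem sumDiffInvMatrix_mul : sumDiffInvMatrix * sumDiffMatrix = 1 := by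
  ext i j
  fin_cases i <;> fin_cases j <;>
    simp [sumDiffInvMatrix, sumDiffMatrix, Matrix.mul_apply, Fin.sum_univ_two] <;> norm_num

theorem sumDiffMatrix_mul : sumDiffMatrix * sumDiffInvMatrix = 1 := by
  ext i j
  rcases i with i | i <;> rcases j with j | j <;> fin_cases i <;> fin_cases j <;>
    simp [sumDiffInvMatrix, sumDiffMatrix, Matrix.mul_apply, Fin.sum_univ_four] <;> norm_num

theorem stabilityMatrix_eq (V : ℝ → ℝ) (φ : ℝ → ℝ → ℝ) (ω : ℝ → ℝ) (μ : ℂ) (ε : ℝ) (x : ℝ) :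
    stabilityMatrix V φ ω μ ε x =
      sumDiffInvMatrix * coupledHillMatrix V φ ω μ ε x * sumDiffMatrix := by
  ext i j
  fin_cases i <;> fin_cases j <;>
    simp [stabilityMatrix, coupledHillMatrix, hillMatrix, sumDiffInvMatrix, sumDiffMatrix,
      Matrix.mul_apply, Fin.sum_univ_two] <;> ring

theorem IsSolutionOperator.conj {m n : Type*} [Fintype m] [DecidableEq m] [Fintype n]
    [DecidableEq n] {A U : ℝ → Matrix m m ℂ} (hU : IsSolutionOperator A U) {P : Matrix n m ℂ}
    {Q : Matrix m n ℂ} (hPQ : P * Q = 1) (hQP : Q * P = 1) :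
    IsSolutionOperator (fun x => P * A x * Q) (fun x => P * U x * Q) := by
  refine ⟨by simp only [hU.1, Matrix.mul_one, hPQ], fun x i j => ?_⟩
  have h : P * A x * Q * (P * U x * Q) = P * (A x * U x) * Q := by
    simp only [Matrix.mul_assoc]
    rw [← Matrix.mul_assoc Q P, hQP, Matrix.one_mul]
  have hexp : ∀ N : Matrix m m ℂ, (P * N * Q) i j = ∑ k, (∑ l, P i l * N l k) * Q k j :=
    fun N => by simp only [Matrix.mul_apply]
  simp only [h, hexp]
  exact HasDerivAt.fun_sum fun k _ => (HasDerivAt.fun_sum fun l _ =>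
    (hU.2 x l k).const_mul (P i l)).mul_const (Q k j)

theorem continuous_coupledHillMatrix {V : ℝ → ℝ} (hV : Continuous V) {φ : ℝ → ℝ → ℝ} (ω : ℝ → ℝ)
    (μ : ℂ) {ε : ℝ} (hφ : Continuous fun x => φ x ε) :
    Continuous (coupledHillMatrix V φ ω μ ε) := by
  have h1 := continuous_hillMatrix hV (ω 0) μ
  have h2 := continuous_hillMatrix hV (ω 0) (-μ)
  unfold coupledHillMatrix
  exact Continuous.matrix_fromBlocks (by fun_prop) (by fun_prop) (by fun_prop) (by fun_prop)

theorem monodromy_stabilityMatrix {V : ℝ → ℝ} (hV : Continuous V) {φ : ℝ → ℝ → ℝ} (ω : ℝ → ℝ)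
    (μ : ℂ) {ε : ℝ} (hφ : Continuous fun x => φ x ε) :
    monodromy (stabilityMatrix V φ ω μ ε) =
      sumDiffInvMatrix * monodromy (coupledHillMatrix V φ ω μ ε) * sumDiffMatrix := by
  have hc := continuous_coupledHillMatrix hV ω μ hφ
  obtain ⟨U, hU⟩ := exists_isSolutionOperator hc
  have hs : stabilityMatrix V φ ω μ ε =
      fun x => sumDiffInvMatrix * coupledHillMatrix V φ ω μ ε x * sumDiffMatrix :=
    funext fun x => stabilityMatrix_eq V φ ω μ ε x
  rw [hs, monodromy_eq hc hU, monodromy_eq ((continuous_const.matrix_mul hc).matrix_mul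
    continuous_const) (hU.conj sumDiffInvMatrix_mul sumDiffMatrix_mul)]

/-- The solution operator is symplectic. In block form this says, in particular, that the
Wronskians of its first two and of its last two columns are `1`. -/
theorem det_add_det_of_isSolutionOperator {V : ℝ → ℝ} {φ : ℝ → ℝ → ℝ} {ω : ℝ → ℝ} {μ : ℂ} {ε : ℝ}
    {U : ℝ → Matrix (Fin 2 ⊕ Fin 2) (Fin 2 ⊕ Fin 2) ℂ}
    (hU : IsSolutionOperator (coupledHillMatrix V φ ω μ ε) U) (x : ℝ) :
    (U x).toBlocks₁₁.det + (U x).toBlocks₂₁.det = 1 ∧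
      (U x).toBlocks₁₂.det + (U x).toBlocks₂₂.det = 1 := by
  have hd := hU.2
  simp only [coupledHillMatrix, hillMatrix, Matrix.mul_apply, Fintype.sum_sum_type,
    Fin.sum_univ_two] at hd
  have key : ∀ i j y, HasDerivAt (fun z =>
      U z (.inl 0) i * U z (.inl 1) j - U z (.inl 0) j * U z (.inl 1) i +
        (U z (.inr 0) i * U z (.inr 1) j - U z (.inr 0) j * U z (.inr 1) i)) 0 y := by
    intro i j y
    have h1 : ∀ c, HasDerivAt (fun z => U z (.inl 0) c) (U y (.inl 1) c) y := fun c =>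
      (hd y (.inl 0) c).congr_deriv (by simp)
    have h2 := fun c => hd y (.inl 1) c
    have h3 : ∀ c, HasDerivAt (fun z => U z (.inr 0) c) (U y (.inr 1) c) y := fun c =>
      (hd y (.inr 0) c).congr_deriv (by simp)
    have h4 := fun c => hd y (.inr 1) c
    refine ((((h1 i).mul (h2 j)).sub ((h1 j).mul (h2 i))).add
      (((h3 i).mul (h4 j)).sub ((h3 j).mul (h4 i)))).congr_deriv ?_
    simp
    ring
  have hconst := fun i j => is_const_of_deriv_eq_zero
    (fun y => (key i j y).differentiableAt) (fun y => (key i j y).deriv) x 0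
  have e1 := hconst (.inl 0) (.inl 1)
  have e2 := hconst (.inr 0) (.inr 1)
  simp [hU.1] at e1 e2
  simp only [det_fin_two, toBlocks₁₁, toBlocks₁₂, toBlocks₂₁, toBlocks₂₂, Matrix.of_apply]
  exact ⟨by linear_combination e1, by linear_combination e2⟩

theorem trace_fromBlocks {m n R : Type*} [Fintype m] [Fintype n] [AddCommMonoid R]
    (a : Matrix m m R) (b : Matrix m n R) (c : Matrix n m R) (d : Matrix n n R) :
    (fromBlocks a b c d).trace = a.trace + d.trace := by
  simp [Matrix.trace, Fintype.sum_sum_type]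

/-- The radicand of the Floquet discriminants in block form. It is a quadratic expression in
quantities which vanish when `a` and `d` have equal traces and `b = c = 0`. -/
theorem radicand_fromBlocks {a b c d : Matrix (Fin 2) (Fin 2) ℂ} (h₁ : a.det + c.det = 1)
    (h₂ : b.det + d.det = 1) :
    -(fromBlocks a b c d).trace ^ 2 + 2 * ((fromBlocks a b c d) ^ 2).trace + 8 =
      (a.trace - d.trace) ^ 2 + 4 * (b + c.adjugate).det := by
  rw [sq (fromBlocks a b c d), fromBlocks_multiply, trace_fromBlocks, trace_fromBlocks]
  rw [det_fin_two, det_fin_two] at h₁ h₂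
  simp only [adjugate_fin_two, trace_fin_two, det_fin_two, Matrix.add_apply, Matrix.mul_apply,
    Fin.sum_univ_two, Matrix.of_apply, Matrix.cons_val', Matrix.cons_val_zero,
    Matrix.cons_val_one, Matrix.cons_val_fin_one]
  linear_combination (-4) * h₁ - 4 * h₂

theorem trace_conj {P : Matrix (Fin 4) (Fin 2 ⊕ Fin 2) ℂ} {Q : Matrix (Fin 2 ⊕ Fin 2) (Fin 4) ℂ}
    (hQP : Q * P = 1) (M : Matrix (Fin 2 ⊕ Fin 2) (Fin 2 ⊕ Fin 2) ℂ) :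
    (P * M * Q).trace = M.trace ∧ ((P * M * Q) ^ 2).trace = (M ^ 2).trace := by
  have h : ∀ N : Matrix (Fin 2 ⊕ Fin 2) (Fin 2 ⊕ Fin 2) ℂ, (P * N * Q).trace = N.trace := by
    intro N
    rw [trace_mul_comm, ← Matrix.mul_assoc, hQP, Matrix.one_mul]
  refine ⟨h M, ?_⟩
  rw [← h (M ^ 2), sq, sq]
  congr 1
  simp only [Matrix.mul_assoc]
  rw [← Matrix.mul_assoc Q P, hQP, Matrix.one_mul]

/-- First order expansion of the monodromy matrix of the coupled system at `(μ*, 0)`. With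
`ω₁ = ω'(0)` the functions are `f = 2 (2 φ(·, 0)² - ω₁)` and `g = 2 φ(·, 0)²`; the argument needs
only that they are real. -/
theorem exists_norm_monodromy_coupledHillMatrix_sub_le {V : ℝ → ℝ} (hV : Continuous V) {δ : ℝ}
    {φ : ℝ → ℝ → ℝ} {ω : ℝ → ℝ} (hφ : IsStandingWaveFamily V δ φ ω) {μs : ℂ}
    {U₁ U₂ : ℝ → Matrix (Fin 2) (Fin 2) ℂ}
    (hU₁ : IsSolutionOperator (hillMatrix V (ω 0) μs) U₁)
    (hU₂ : IsSolutionOperator (hillMatrix V (ω 0) (-μs)) U₂) :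
    ∃ f g : ℝ → ℝ, ∃ r C : ℝ, 0 < r ∧ r ≤ δ / 2 ∧ r ≤ 1 / 2 ∧ ∀ (μ : ℂ) (ε : ℝ),
      ‖μ - μs‖ < r → |ε| < r → ∀ i j,
      ‖(monodromy (coupledHillMatrix V φ ω μ ε) - fromBlocks (U₁ 1) 0 0 (U₂ 1) *
        (1 + fromBlocks
          ((-2 * (μ - μs)) • overlapMatrix U₁ U₁ 1 +
            (ε : ℂ) • overlapMatrix U₁ U₁ (fun x => f x))
          ((ε : ℂ) • overlapMatrix U₁ U₂ (fun x => g x))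
          ((ε : ℂ) • overlapMatrix U₂ U₁ (fun x => g x))
          ((2 * (μ - μs)) • overlapMatrix U₂ U₂ 1 +
            (ε : ℂ) • overlapMatrix U₂ U₂ (fun x => f x)))) i j‖
        ≤ C * (‖μ - μs‖ + |ε|) ^ 2 := by
  have hδ := hφ.pos
  have h0 : (0 : ℝ) ∈ Ioo (-δ) δ := ⟨by linarith, hδ⟩
  obtain ⟨C₁, hC₁0, hC₁⟩ := hφ.exists_abs_sub_le
  obtain ⟨ω₁, C₂, r, hr, hrδ, hC₂⟩ := hφ.exists_frequency_expansion
  have hφ0 : Continuous fun x => φ x 0 := (hφ.contDiff h0).continuous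
  set f : ℝ → ℝ := fun x => 2 * (2 * φ x 0 ^ 2 - ω₁) with hf
  set g : ℝ → ℝ := fun x => 2 * φ x 0 ^ 2 with hg
  have hfc : Continuous f := by fun_prop
  have hgc : Continuous g := by fun_prop
  obtain ⟨C₃, hC₃⟩ := (isCompact_Icc (a := (0 : ℝ)) (b := 1)).exists_bound_of_continuousOn
    hfc.continuousOn
  obtain ⟨C₄, hC₄⟩ := (isCompact_Icc (a := (0 : ℝ)) (b := 1)).exists_bound_of_continuousOn
    hgc.continuousOn
  have hC₃0 : 0 ≤ C₃ := (norm_nonneg _).trans (hC₃ 0 (by simp))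
  have hC₄0 : 0 ≤ C₄ := (norm_nonneg _).trans (hC₄ 0 (by simp))
  have hC₂0 : 0 ≤ C₂ := by
    have := (abs_nonneg _).trans (hC₂ r (abs_of_pos hr).le)
    exact nonneg_of_mul_nonneg_left this (by positivity)
  have hu₁ := hU₁.continuous
  have hu₂ := hU₂.continuous
  -- the unperturbed system consists of two uncoupled copies of Hill's equation
  set A₀ : ℝ → Matrix (Fin 2 ⊕ Fin 2) (Fin 2 ⊕ Fin 2) ℂ := fun x =>
    fromBlocks (hillMatrix V (ω 0) μs x) 0 0 (hillMatrix V (ω 0) (-μs) x) with hA₀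
  set U₀ : ℝ → Matrix (Fin 2 ⊕ Fin 2) (Fin 2 ⊕ Fin 2) ℂ := fun x =>
    fromBlocks (U₁ x) 0 0 (U₂ x) with hU₀
  set Z₀ : ℝ → Matrix (Fin 2 ⊕ Fin 2) (Fin 2 ⊕ Fin 2) ℂ := fun x =>
    fromBlocks (U₁ x).adjugate 0 0 (U₂ x).adjugate with hZ₀
  have hsol : IsSolutionOperator A₀ U₀ := by
    refine ⟨by simp [hU₀, hU₁.1, hU₂.1], fun x i j => ?_⟩
    simp only [hA₀, hU₀, fromBlocks_multiply, Matrix.zero_mul, Matrix.mul_zero, add_zero, zero_add]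
    rcases i with i | i <;> rcases j with j | j
    · simpa using hU₁.2 x i j
    · simpa using hasDerivAt_const x (0 : ℂ)
    · simpa using hasDerivAt_const x (0 : ℂ)
    · simpa using hU₂.2 x i j
  have hZ0 : Z₀ 0 = 1 := by simp [hZ₀, hU₁.1, hU₂.1]
  have hZ' : ∀ x i j, HasDerivAt (fun y => Z₀ y i j) ((-(Z₀ x * A₀ x)) i j) x := by
    intro x i j
    simp only [hA₀, hZ₀, fromBlocks_multiply, Matrix.zero_mul, Matrix.mul_zero, add_zero,
      zero_add, fromBlocks_neg]
    rcases i with i | i <;> rcases j with j | j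
    · simpa using hasDerivAt_adjugate_hill hU₁ x i j
    · simpa using hasDerivAt_const x (0 : ℂ)
    · simpa using hasDerivAt_const x (0 : ℂ)
    · simpa using hasDerivAt_adjugate_hill hU₂ x i j
  have hUZ : ∀ x, U₀ x * Z₀ x = 1 := by
    intro x
    simp [hU₀, hZ₀, fromBlocks_multiply, mul_adjugate,
      det_eq_one_of_isSolutionOperator_hill hU₁, det_eq_one_of_isSolutionOperator_hill hU₂]
  have hA₀c : Continuous A₀ := Continuous.matrix_fromBlocks (continuous_hillMatrix hV _ _)
    continuous_const continuous_const (continuous_hillMatrix hV _ _)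
  obtain ⟨C, hC⟩ := exists_norm_monodromy_sub_le hsol hZ0 hZ' hUZ hA₀c
    (K := 2 + C₃ + C₄ + (8 * C₁ ^ 2 + 2 * C₂)) (by positivity)
  refine ⟨f, g, min r (1 / 2), C, lt_min hr (by norm_num), (min_le_left _ _).trans hrδ,
    min_le_right _ _, fun μ ε hμ hε => ?_⟩
  have hμ2 := hμ.trans_le (min_le_right _ _)
  have hε2 := hε.trans_le (min_le_right _ _)
  have hε1 := hε.le.trans (min_le_left _ _)
  have hεδ : ε ∈ Ioo (-δ) δ := by
    have := abs_le.1 hε1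
    exact ⟨by linarith, by linarith⟩
  have hφε : Continuous fun x => φ x ε := (hφ.contDiff hεδ).continuous
  set η : ℝ := ‖μ - μs‖ + |ε| with hη
  have hη0 : 0 ≤ η := by positivity
  have hsη : ‖μ - μs‖ ≤ η := le_add_of_nonneg_right (abs_nonneg _)
  have hεη : |ε| ≤ η := le_add_of_nonneg_left (norm_nonneg _)
  set E : ℝ → Matrix (Fin 2 ⊕ Fin 2) (Fin 2 ⊕ Fin 2) ℂ := fun x => fromBlocks
    ((-2 * (μ - μs) + ε * f x) • !![0, 0; 1, 0]) ((ε * g x : ℂ) • !![0, 0; 1, 0])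
    ((ε * g x : ℂ) • !![0, 0; 1, 0]) ((2 * (μ - μs) + ε * f x) • !![0, 0; 1, 0]) with hE
  have hEc : Continuous E :=
    Continuous.matrix_fromBlocks (by fun_prop) (by fun_prop) (by fun_prop) (by fun_prop)
  have hmain := hC (coupledHillMatrix V φ ω μ ε) E η
    (continuous_coupledHillMatrix hV ω μ hφε) hEc hη0 (by linarith) ?_ ?_
  · have hof : (Matrix.of fun k l => ∫ x in (0 : ℝ)..1, (Z₀ x * E x * U₀ x) k l) = fromBlocks
          ((-2 * (μ - μs)) • overlapMatrix U₁ U₁ 1 +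
            (ε : ℂ) • overlapMatrix U₁ U₁ (fun x => f x))
          ((ε : ℂ) • overlapMatrix U₁ U₂ (fun x => g x))
          ((ε : ℂ) • overlapMatrix U₂ U₁ (fun x => g x))
          ((2 * (μ - μs)) • overlapMatrix U₂ U₂ 1 +
            (ε : ℂ) • overlapMatrix U₂ U₂ (fun x => f x)) := by
      have hlin : ∀ (W W' : ℝ → Matrix (Fin 2) (Fin 2) ℂ) (z : ℂ) (k l : Fin 2),
          Continuous W → Continuous W' →
          ∫ x in (0 : ℝ)..1, ((W x).adjugate * ((z + ε * f x) • !![0, 0; 1, 0]) * W' x :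
            Matrix (Fin 2) (Fin 2) ℂ) k l =
          (z • overlapMatrix W W' 1 + (ε : ℂ) • overlapMatrix W W' (fun x => f x)) k l := by
        intro W W' z k l hW hW'
        have hc : Continuous fun x =>
            ((W x).adjugate * !![0, 0; 1, 0] * W' x : Matrix (Fin 2) (Fin 2) ℂ) k l :=
          (((hW.matrix_adjugate).matrix_mul continuous_const).matrix_mul hW').matrix_elem k l
        have hfc' : Continuous fun x => (f x : ℂ) := Complex.continuous_ofReal.comp hfc
        simp only [Matrix.add_apply, Matrix.smul_apply, overlapMatrix, Matrix.of_apply,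
          Pi.one_apply, one_mul, smul_eq_mul, Matrix.mul_smul, Matrix.smul_mul, add_mul, mul_assoc]
        rw [← intervalIntegral.integral_const_mul, ← intervalIntegral.integral_const_mul]
        simp only [Matrix.mul_assoc] at hc
        exact intervalIntegral.integral_add ((hc.const_mul z).intervalIntegrable _ _)
          (((hfc'.mul hc).const_mul (ε : ℂ)).intervalIntegrable _ _)
      have hlin' : ∀ (W W' : ℝ → Matrix (Fin 2) (Fin 2) ℂ) (k l : Fin 2),
          ∫ x in (0 : ℝ)..1, ((W x).adjugate * ((ε * g x : ℂ) • !![0, 0; 1, 0]) * W' x :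
            Matrix (Fin 2) (Fin 2) ℂ) k l =
          ((ε : ℂ) • overlapMatrix W W' (fun x => g x)) k l := by
        intro W W' k l
        simp only [Matrix.smul_apply, overlapMatrix, Matrix.of_apply,
          smul_eq_mul, Matrix.mul_smul, Matrix.smul_mul, mul_assoc]
        exact intervalIntegral.integral_const_mul _ _
      ext k l
      simp only [Matrix.of_apply, hE, hZ₀, hU₀, fromBlocks_multiply, Matrix.zero_mul,
        Matrix.mul_zero, add_zero, zero_add]
      rcases k with k | k <;> rcases l with l | l
      · exact hlin U₁ U₁ _ k l hu₁ hu₁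
      · exact hlin' U₁ U₂ k l
      · exact hlin' U₂ U₁ k l
      · exact hlin U₂ U₂ _ k l hu₂ hu₂
    rw [hof] at hmain
    exact hmain
  · intro x hx i j
    have b1 : ‖(ε * f x : ℂ)‖ ≤ C₃ * η := by
      rw [norm_mul, Complex.norm_real, Complex.norm_real, mul_comm]
      exact mul_le_mul (hC₃ x hx) hεη (norm_nonneg _) hC₃0
    have b2 : ‖(ε * g x : ℂ)‖ ≤ C₄ * η := by
      rw [norm_mul, Complex.norm_real, Complex.norm_real, mul_comm]
      exact mul_le_mul (hC₄ x hx) hεη (norm_nonneg _) hC₄0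
    have b3 : ‖(2 * (μ - μs) : ℂ)‖ ≤ 2 * η := by
      rw [norm_mul, Complex.norm_ofNat]
      linarith
    have b4 : 0 ≤ (8 * C₁ ^ 2 + 2 * C₂) * η := by positivity
    have b5 : ‖(-2 * (μ - μs) + ε * f x : ℂ)‖ ≤ 2 * η + C₃ * η := by
      refine (norm_add_le _ _).trans (add_le_add ?_ b1)
      rwa [neg_mul, norm_neg]
    have b6 : ‖(2 * (μ - μs) + ε * f x : ℂ)‖ ≤ 2 * η + C₃ * η :=
      (norm_add_le _ _).trans (add_le_add b3 b1)
    have b7 : 0 ≤ C₃ * η := by positivity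
    have b8 : 0 ≤ C₄ * η := by positivity
    have b9 : 0 ≤ (2 + C₃ + C₄ + (8 * C₁ ^ 2 + 2 * C₂)) * η := by positivity
    rcases i with i | i <;> rcases j with j | j <;> fin_cases i <;> fin_cases j <;>
      simp only [hE, fromBlocks_apply₁₁, fromBlocks_apply₁₂, fromBlocks_apply₂₁,
        fromBlocks_apply₂₂, Matrix.smul_apply, Matrix.of_apply, Matrix.cons_val', Fin.zero_eta,
        Fin.mk_one, Matrix.cons_val_zero, Matrix.cons_val_one, Matrix.cons_val_fin_one,
        smul_eq_mul, mul_zero, mul_one, norm_zero, b9] <;>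
      linarith
  · intro x hx i j
    obtain ⟨p1, p2⟩ := hC₁ x hx ε (hε1.trans hrδ)
    obtain ⟨p3, -⟩ := hC₁ x hx 0 (by simp; linarith)
    have hsq : |ε * φ x ε ^ 2 - ε * φ x 0 ^ 2| ≤ 2 * C₁ ^ 2 * η ^ 2 := by
      have : ε * φ x ε ^ 2 - ε * φ x 0 ^ 2 = ε * ((φ x ε + φ x 0) * (φ x ε - φ x 0)) := by ring
      rw [this, abs_mul, abs_mul]
      calc _ ≤ η * ((C₁ + C₁) * (C₁ * η)) := by
            gcongr
            · exact (abs_add_le _ _).trans (add_le_add p1 p3)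
            · exact p2.trans (by gcongr)
        _ = _ := by ring
    have hω : |ω ε - ω 0 - ω₁ * ε| ≤ C₂ * η ^ 2 := (hC₂ ε hε1).trans (by gcongr)
    have b1 : ‖(2 * (2 * ε * φ x ε ^ 2 - (ω ε - ω 0) : ℝ) - ε * f x : ℂ)‖ ≤
        (8 * C₁ ^ 2 + 2 * C₂) * η ^ 2 := by
      have : (2 * (2 * ε * φ x ε ^ 2 - (ω ε - ω 0) : ℝ) - ε * f x : ℂ) =
          ((4 * (ε * φ x ε ^ 2 - ε * φ x 0 ^ 2) - 2 * (ω ε - ω 0 - ω₁ * ε) : ℝ) : ℂ) := by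
        simp only [hf]
        push_cast
        ring
      rw [this, Complex.norm_real, Real.norm_eq_abs]
      refine (abs_sub _ _).trans ?_
      rw [abs_mul, abs_mul, abs_two, abs_of_pos (four_pos : (0 : ℝ) < 4)]
      linarith
    have b2 : ‖(2 * (ε * φ x ε ^ 2 : ℝ) - ε * g x : ℂ)‖ ≤ 4 * C₁ ^ 2 * η ^ 2 := by
      have : (2 * (ε * φ x ε ^ 2 : ℝ) - ε * g x : ℂ) =
          ((2 * (ε * φ x ε ^ 2 - ε * φ x 0 ^ 2) : ℝ) : ℂ) := by
        simp only [hg]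
        push_cast
        ring
      rw [this, Complex.norm_real, Real.norm_eq_abs, abs_mul, abs_two]
      linarith
    have c1 : (8 * C₁ ^ 2 + 2 * C₂) * η ^ 2 ≤
        (2 + C₃ + C₄ + (8 * C₁ ^ 2 + 2 * C₂)) * η ^ 2 :=
      mul_le_mul_of_nonneg_right (by linarith) (sq_nonneg _)
    have c2 : 4 * C₁ ^ 2 * η ^ 2 ≤
        (2 + C₃ + C₄ + (8 * C₁ ^ 2 + 2 * C₂)) * η ^ 2 :=
      mul_le_mul_of_nonneg_right (by nlinarith [sq_nonneg C₁]) (sq_nonneg _)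
    have c3 : 0 ≤ (2 + C₃ + C₄ + (8 * C₁ ^ 2 + 2 * C₂)) * η ^ 2 := by positivity
    have hz : ∀ z : ℂ, z = 0 → ‖z‖ ≤ (2 + C₃ + C₄ + (8 * C₁ ^ 2 + 2 * C₂)) * η ^ 2 := by
      rintro z rfl
      simpa using c3
    rcases i with i | i <;> rcases j with j | j <;> fin_cases i <;> fin_cases j
    · exact hz _ (by simp [hE, hA₀, coupledHillMatrix, hillMatrix])
    · exact hz _ (by simp [hE, hA₀, coupledHillMatrix, hillMatrix])
    · refine (le_of_eq (congrArg _ ?_)).trans (b1.trans c1)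
      simp [hE, hA₀, coupledHillMatrix, hillMatrix]
      ring
    · exact hz _ (by simp [hE, hA₀, coupledHillMatrix, hillMatrix])
    · exact hz _ (by simp [hE, hA₀, coupledHillMatrix])
    · exact hz _ (by simp [hE, hA₀, coupledHillMatrix])
    · refine (le_of_eq (congrArg _ ?_)).trans (b2.trans c2)
      simp [hE, hA₀, coupledHillMatrix]
    · exact hz _ (by simp [hE, hA₀, coupledHillMatrix])
    · exact hz _ (by simp [hE, hA₀, coupledHillMatrix])
    · exact hz _ (by simp [hE, hA₀, coupledHillMatrix])
    · refine (le_of_eq (congrArg _ ?_)).trans (b2.trans c2)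
      simp [hE, hA₀, coupledHillMatrix]
    · exact hz _ (by simp [hE, hA₀, coupledHillMatrix])
    · exact hz _ (by simp [hE, hA₀, coupledHillMatrix, hillMatrix])
    · exact hz _ (by simp [hE, hA₀, coupledHillMatrix, hillMatrix])
    · refine (le_of_eq (congrArg _ ?_)).trans (b1.trans c1)
      simp [hE, hA₀, coupledHillMatrix, hillMatrix]
      ring
    · exact hz _ (by simp [hE, hA₀, coupledHillMatrix, hillMatrix])

end BlockSystem

/-! ### Intertwiners of elliptic matrices -/

section Krein

open Matrix

/-- The sign condition behind the definiteness of like Krein signs: `y = m₁ b - b m₂⁻¹` intertwines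
the elliptic matrices `m₂` and `m₁`, which rotate in the same direction, so `y` cannot reverse
orientation. -/
theorem det_mul_sub_mul_adjugate_nonneg {m₁ m₂ : Matrix (Fin 2) (Fin 2) ℝ}
    (b : Matrix (Fin 2) (Fin 2) ℝ) (h₁ : m₁.det = 1) (h₂ : m₂.det = 1)
    (htr : m₁.trace = m₂.trace) (hell : m₁.trace ^ 2 < 4) (hsign : 0 < m₁ 0 1 * m₂ 0 1) :
    0 ≤ (m₁ * b - b * m₂.adjugate).det := by
  set y := m₁ * b - b * m₂.adjugate with hy
  have hcomm : m₁ * y = y * m₂ := by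
    -- the Cayley-Hamilton theorem for `m₁`
    have hCH : m₁ * m₁ + 1 = m₁.trace • m₁ := by
      rw [det_fin_two] at h₁
      ext i j
      fin_cases i <;> fin_cases j <;> simp [Matrix.mul_apply, Fin.sum_univ_two, trace_fin_two] <;>
        linarith
    have hadj : m₂.adjugate + m₂ = m₂.trace • 1 := by
      rw [adjugate_fin_two, trace_fin_two]
      ext i j
      fin_cases i <;> fin_cases j <;> simp [add_comm]
    have e : m₁ * y - y * m₂ = (m₁ * m₁ + 1) * b - m₁ * b * (m₂.adjugate + m₂) := by
      have h3 : m₂.adjugate * m₂ = 1 := by rw [adjugate_mul, h₂, one_smul]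
      have h4 : b * m₂.adjugate * m₂ = b := by rw [Matrix.mul_assoc, h3, Matrix.mul_one]
      rw [hy, Matrix.sub_mul, h4]
      noncomm_ring
    rw [hCH, hadj, htr, Matrix.smul_mul, Matrix.mul_smul, Matrix.mul_one, sub_self] at e
    exact sub_eq_zero.1 e
  have c0 := congrFun (congrFun hcomm 0) 1
  have c1 := congrFun (congrFun hcomm 1) 1
  simp only [Matrix.mul_apply, Fin.sum_univ_two] at c0 c1
  rw [trace_fin_two] at hell
  rw [det_fin_two] at h₁ ⊢
  -- `m₁` preserves a definite quadratic form, evaluated here at the second column of `y`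
  have key : (y 0 0 * y 1 1 - y 0 1 * y 1 0) * (m₁ 0 1 * m₂ 0 1) =
      (m₁ 0 1 * y 1 1 - (m₁ 1 1 - m₁ 0 0) / 2 * y 0 1) ^ 2 +
        (4 - (m₁ 0 0 + m₁ 1 1) ^ 2) / 4 * y 0 1 ^ 2 := by
    linear_combination (-m₁ 0 1 * y 1 1) * c0 + m₁ 0 1 * y 0 1 * c1 + y 0 1 ^ 2 * h₁
  refine nonneg_of_mul_nonneg_left (b := m₁ 0 1 * m₂ 0 1) ?_ hsign
  rw [key]
  have : 0 ≤ (4 - (m₁ 0 0 + m₁ 1 1) ^ 2) / 4 := by linarith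
  positivity

end Krein

/-! ### Floquet discriminants of a perturbed block matrix -/

section Expansion

open Matrix

theorem norm_mul_sub_mul_le {z z₀ w w₀ : ℂ} {L C η : ℝ} (hC : 0 ≤ C) (hη : 0 ≤ η) (hη1 : η ≤ 1)
    (hz₀ : ‖z₀‖ ≤ L * η) (hw₀ : ‖w₀‖ ≤ L * η) (hz : ‖z - z₀‖ ≤ C * η ^ 2)
    (hw : ‖w - w₀‖ ≤ C * η ^ 2) : ‖z * w - z₀ * w₀‖ ≤ (2 * L * C + C ^ 2) * η ^ 3 := by
  have e : z * w - z₀ * w₀ = z₀ * (w - w₀) + (z - z₀) * w₀ + (z - z₀) * (w - w₀) := by ring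
  rw [e]
  refine (norm_add₃_le).trans ?_
  rw [norm_mul, norm_mul, norm_mul]
  have hL : 0 ≤ L * η := (norm_nonneg _).trans hz₀
  have hCη : 0 ≤ C * η ^ 2 := by positivity
  calc _ ≤ L * η * (C * η ^ 2) + C * η ^ 2 * (L * η) + C * η ^ 2 * (C * η ^ 2) := by gcongr
    _ = 2 * L * C * η ^ 3 + C ^ 2 * (η ^ 3 * η) := by ring
    _ ≤ 2 * L * C * η ^ 3 + C ^ 2 * (η ^ 3 * 1) := by gcongr
    _ = _ := by ring

/-- The Floquet discriminants of a matrix similar to a block matrix with the Wronskian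
identities. -/
theorem discriminants_conj {P : Matrix (Fin 4) (Fin 2 ⊕ Fin 2) ℂ}
    {Q : Matrix (Fin 2 ⊕ Fin 2) (Fin 4) ℂ} (hQP : Q * P = 1)
    {a b c d : Matrix (Fin 2) (Fin 2) ℂ} (h₁ : a.det + c.det = 1) (h₂ : b.det + d.det = 1) :
    discriminantPlus (P * fromBlocks a b c d * Q) = (a.trace + d.trace) / 2 +
        Complex.sqrt ((a.trace - d.trace) ^ 2 + 4 * (b + c.adjugate).det) / 2 ∧
      discriminantMinus (P * fromBlocks a b c d * Q) = (a.trace + d.trace) / 2 -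
        Complex.sqrt ((a.trace - d.trace) ^ 2 + 4 * (b + c.adjugate).det) / 2 := by
  obtain ⟨e1, e2⟩ := trace_conj hQP (fromBlocks a b c d)
  rw [discriminantPlus, discriminantMinus, e1, e2, radicand_fromBlocks h₁ h₂, trace_fromBlocks]
  exact ⟨by ring, by ring⟩

/-- Expansion of the trace, of the trace difference, and of the off-diagonal part, for a block
matrix which is a first order perturbation of `m₁ ⊕ m₂`. -/
theorem fromBlocks_expansion {m₁ m₂ o₁ o₂ p₁ p₂ q q' : Matrix (Fin 2) (Fin 2) ℂ}
    (hq : q'.adjugate = -q) {s e : ℂ} {B : ℝ} {a b c d : Matrix (Fin 2) (Fin 2) ℂ}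
    (h : ∀ i j, ‖(fromBlocks a b c d - fromBlocks m₁ 0 0 m₂ * (1 + fromBlocks
      ((-2 * s) • o₁ + e • p₁) (e • q) (e • q') ((2 * s) • o₂ + e • p₂))) i j‖ ≤ B) :
    ‖(a.trace + d.trace) - (m₁.trace + m₂.trace + (-2 * (m₁ * o₁).trace + 2 * (m₂ * o₂).trace) * s
        + ((m₁ * p₁).trace + (m₂ * p₂).trace) * e)‖ ≤ 4 * B ∧
      ‖(a.trace - d.trace) - (m₁.trace - m₂.trace + (-2 * (m₁ * o₁).trace - 2 * (m₂ * o₂).trace) * s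
        + ((m₁ * p₁).trace - (m₂ * p₂).trace) * e)‖ ≤ 4 * B ∧
      ∀ i j, ‖(b + c.adjugate) i j - e * (m₁ * q - q * m₂.adjugate) i j‖ ≤ 4 * B := by
  have hB : 0 ≤ B := (norm_nonneg _).trans (h (.inl 0) (.inl 0))
  rw [← fromBlocks_one, fromBlocks_add, fromBlocks_multiply] at h
  simp only [Matrix.zero_mul, add_zero, zero_add] at h
  obtain ⟨ra, hra⟩ : ∃ ra, ra = a - m₁ * (1 + ((-2 * s) • o₁ + e • p₁)) := ⟨_, rfl⟩
  obtain ⟨rb, hrb⟩ : ∃ rb, rb = b - m₁ * (e • q) := ⟨_, rfl⟩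
  obtain ⟨rc, hrc⟩ : ∃ rc, rc = c - m₂ * (e • q') := ⟨_, rfl⟩
  obtain ⟨rd, hrd⟩ : ∃ rd, rd = d - m₂ * (1 + ((2 * s) • o₂ + e • p₂)) := ⟨_, rfl⟩
  have ha : ∀ i j, ‖ra i j‖ ≤ B := fun i j => by simpa [hra] using h (.inl i) (.inl j)
  have hb : ∀ i j, ‖rb i j‖ ≤ B := fun i j => by simpa [hrb] using h (.inl i) (.inr j)
  have hc : ∀ i j, ‖rc i j‖ ≤ B := fun i j => by simpa [hrc] using h (.inr i) (.inl j)
  have hd : ∀ i j, ‖rd i j‖ ≤ B := fun i j => by simpa [hrd] using h (.inr i) (.inr j)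
  have hta : ra.trace = a.trace -
      (m₁.trace - 2 * (m₁ * o₁).trace * s + (m₁ * p₁).trace * e) := by
    rw [hra, trace_sub, mul_add, mul_add, Matrix.mul_smul, Matrix.mul_smul, trace_add, trace_add,
      trace_smul, trace_smul, mul_one, smul_eq_mul, smul_eq_mul]
    ring
  have htd : rd.trace = d.trace -
      (m₂.trace + 2 * (m₂ * o₂).trace * s + (m₂ * p₂).trace * e) := by
    rw [hrd, trace_sub, mul_add, mul_add, Matrix.mul_smul, Matrix.mul_smul, trace_add, trace_add,
      trace_smul, trace_smul, mul_one, smul_eq_mul, smul_eq_mul]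
    ring
  have hna : ‖ra.trace‖ ≤ 2 * B := by
    rw [trace_fin_two]
    linarith [norm_add_le (ra 0 0) (ra 1 1), ha 0 0, ha 1 1]
  have hnd : ‖rd.trace‖ ≤ 2 * B := by
    rw [trace_fin_two]
    linarith [norm_add_le (rd 0 0) (rd 1 1), hd 0 0, hd 1 1]
  refine ⟨?_, ?_, fun i j => ?_⟩
  · refine (le_of_eq (congrArg _ ?_)).trans ((norm_add_le ra.trace rd.trace).trans (by linarith))
    rw [hta, htd]
    ring
  · refine (le_of_eq (congrArg _ ?_)).trans ((norm_sub_le ra.trace rd.trace).trans (by linarith))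
    rw [hta, htd]
    ring
  · have hadd : ∀ u v : Matrix (Fin 2) (Fin 2) ℂ, (u + v).adjugate = u.adjugate + v.adjugate := by
      intro u v
      simp only [adjugate_fin_two]
      ext k l
      fin_cases k <;> fin_cases l <;> simp [add_comm]
    have hcq : c.adjugate = rc.adjugate - e • (q * m₂.adjugate) := by
      have : c = rc + m₂ * (e • q') := by rw [hrc, sub_add_cancel]
      rw [this, hadd, adjugate_mul_distrib, adjugate_smul, hq]
      simp [sub_eq_add_neg]
    have e1 : (b + c.adjugate) i j - e * (m₁ * q - q * m₂.adjugate) i j =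
        rb i j + rc.adjugate i j := by
      rw [hcq, hrb]
      simp
      ring
    have hrc' : ‖rc.adjugate i j‖ ≤ B := by
      rw [adjugate_fin_two]
      fin_cases i <;> fin_cases j <;> simp [hc]
    rw [e1]
    linarith [norm_add_le (rb i j) (rc.adjugate i j), hb i j]

end Expansion

/-! ### Expansion of the Floquet discriminants -/

theorem theorem3 (V : ℝ → ℝ) (hV : Continuous V) (hVper : ∀ x, V (x + 1) = V x)
    (δ : ℝ) (φ : ℝ → ℝ → ℝ) (ω : ℝ → ℝ) (hφ : IsStandingWaveFamily V δ φ ω)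
    (k : ℂ → ℂ) (hk : k = hillDiscriminant V (ω 0))
    (M : ℂ → ℝ → Matrix (Fin 4) (Fin 4) ℂ)
    (hM : M = fun μ ε => monodromy (stabilityMatrix V φ ω μ ε))
    (μs : ℂ) (hμs : k μs = k (-μs)) :
    ∃ α β γ : ℂ,
      (∃ r C : ℝ, 0 < r ∧ r ≤ δ ∧ ∃ E₁ E₂ : ℂ → ℝ → ℂ,
        ∀ (μ : ℂ) (ε : ℝ), ‖μ - μs‖ < r → |ε| < r →
          discriminantPlus (M μ ε)
            = k μs + (deriv k μs - deriv k (-μs)) / 2 * (μ - μs) + α * ε + E₁ μ ε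
              + Complex.sqrt ((deriv k μs + deriv k (-μs)) ^ 2 * (μ - μs) ^ 2
                  + β * ε * (μ - μs) + γ * ε ^ 2 + E₂ μ ε) / 2 ∧
          discriminantMinus (M μ ε)
            = k μs + (deriv k μs - deriv k (-μs)) / 2 * (μ - μs) + α * ε + E₁ μ ε
              - Complex.sqrt ((deriv k μs + deriv k (-μs)) ^ 2 * (μ - μs) ^ 2
                  + β * ε * (μ - μs) + γ * ε ^ 2 + E₂ μ ε) / 2 ∧
          ‖E₁ μ ε‖ ≤ C * (|ε| ^ 2 + ‖μ - μs‖ ^ 2 + |ε| * ‖μ - μs‖) ∧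
          ‖E₂ μ ε‖ ≤ C * (|ε| ^ 3 + ‖μ - μs‖ ^ 3 + |ε| * ‖μ - μs‖ ^ 2
            + |ε| ^ 2 * ‖μ - μs‖)) ∧
      (∀ m : ℝ, μs = m → ∃ a b c : ℝ, α = a ∧ β = b ∧ γ = c ∧
        (-2 < (k m).re → (k m).re < 2 →
          SignType.sign (deriv k m).re = SignType.sign (deriv k (-m)).re →
          ∀ s e : ℝ, 0 ≤ ((deriv k m).re + (deriv k (-m)).re) ^ 2 * s ^ 2
            + b * e * s + c * e ^ 2)) := by
  obtain ⟨U₁, hU₁, hr₁⟩ := exists_hill_solution hV (ω 0) μs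
  obtain ⟨U₂, hU₂, hr₂⟩ := exists_hill_solution hV (ω 0) (-μs)
  obtain ⟨f, g, r, C, hr, hrδ, hr2, hexp⟩ :=
    exists_norm_monodromy_coupledHillMatrix_sub_le hV hφ hU₁ hU₂
  have hk₁ : k μs = (U₁ 1).trace := by
    rw [hk, hillDiscriminant, monodromy_eq (continuous_hillMatrix hV _ _) hU₁]
  have hk₂ : k μs = (U₂ 1).trace := by
    rw [hμs, hk, hillDiscriminant, monodromy_eq (continuous_hillMatrix hV _ _) hU₂]
  have hd₁ : deriv k μs = -2 * (U₁ 1 * overlapMatrix U₁ U₁ 1).trace := by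
    rw [hk, (hasDerivAt_hillDiscriminant hV hU₁).deriv]
  have hd₂ : deriv k (-μs) = -2 * (U₂ 1 * overlapMatrix U₂ U₂ 1).trace := by
    rw [hk, (hasDerivAt_hillDiscriminant hV hU₂).deriv]
  set t₁ : ℂ := (U₁ 1 * overlapMatrix U₁ U₁ fun x => f x).trace with ht₁
  set t₂ : ℂ := (U₂ 1 * overlapMatrix U₂ U₂ fun x => f x).trace with ht₂
  set Y : Matrix (Fin 2) (Fin 2) ℂ := U₁ 1 * overlapMatrix U₁ U₂ (fun x => g x) -
    overlapMatrix U₁ U₂ (fun x => g x) * (U₂ 1).adjugate with hY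
  set κ : ℂ := deriv k μs + deriv k (-μs) with hκ
  -- to first order `tr a + tr d` contributes `(t₁ + t₂) ε`, `tr a - tr d` is `κ s + (t₁ - t₂) ε`,
  -- and `b + adj c` is `ε Y`
  refine ⟨(t₁ + t₂) / 2, 2 * κ * (t₁ - t₂), (t₁ - t₂) ^ 2 + 4 * Y.det, ?_, ?_⟩
  · set L : ℝ := ‖κ‖ + ‖t₁ - t₂‖ + ∑ i, ∑ j, ‖Y i j‖ with hL
    have hYL : ∀ i j, ‖Y i j‖ ≤ L := by
      intro i j
      have h1 : ‖Y i j‖ ≤ ∑ j, ‖Y i j‖ :=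
        Finset.single_le_sum (f := fun j => ‖Y i j‖) (fun _ _ => norm_nonneg _) (Finset.mem_univ j)
      have h2 : ∑ j, ‖Y i j‖ ≤ ∑ i, ∑ j, ‖Y i j‖ :=
        Finset.single_le_sum (f := fun i => ∑ j, ‖Y i j‖)
          (fun _ _ => Finset.sum_nonneg fun _ _ => norm_nonneg _) (Finset.mem_univ i)
      linarith [norm_nonneg κ, norm_nonneg (t₁ - t₂)]
    have hL0 : 0 ≤ L := (norm_nonneg _).trans (hYL 0 0)
    set T : ℂ → ℝ → Matrix (Fin 2 ⊕ Fin 2) (Fin 2 ⊕ Fin 2) ℂ := fun μ ε =>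
      monodromy (coupledHillMatrix V φ ω μ ε) with hT
    -- the constant `C` of the expansion is not known to be nonnegative
    set D : ℝ := 4 * |C| with hD
    have hD0 : 0 ≤ D := by positivity
    refine ⟨r, 2 * D + 27 * (2 * L * D + D ^ 2), hr, by linarith [hφ.pos],
      fun μ ε => ((T μ ε).toBlocks₁₁.trace + (T μ ε).toBlocks₂₂.trace) / 2 -
        (k μs + (deriv k μs - deriv k (-μs)) / 2 * (μ - μs) + (t₁ + t₂) / 2 * ε),
      fun μ ε => ((T μ ε).toBlocks₁₁.trace - (T μ ε).toBlocks₂₂.trace) ^ 2 +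
        4 * ((T μ ε).toBlocks₁₂ + (T μ ε).toBlocks₂₁.adjugate).det -
        (κ ^ 2 * (μ - μs) ^ 2 + 2 * κ * (t₁ - t₂) * ε * (μ - μs) +
          ((t₁ - t₂) ^ 2 + 4 * Y.det) * ε ^ 2), fun μ ε hμ hε => ?_⟩
    have hεδ : ε ∈ Ioo (-δ) δ := by
      have := abs_lt.1 hε
      have := hφ.pos
      exact ⟨by linarith, by linarith⟩
    have hφε := (hφ.contDiff hεδ).continuous
    have hwr : (T μ ε).toBlocks₁₁.det + (T μ ε).toBlocks₂₁.det = 1 ∧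
        (T μ ε).toBlocks₁₂.det + (T μ ε).toBlocks₂₂.det = 1 := by
      have hc := continuous_coupledHillMatrix hV ω μ hφε
      obtain ⟨U, hU⟩ := exists_isSolutionOperator hc
      simp only [hT, monodromy_eq hc hU]
      exact det_add_det_of_isSolutionOperator hU 1
    have hMT : M μ ε = sumDiffInvMatrix * Matrix.fromBlocks (T μ ε).toBlocks₁₁ (T μ ε).toBlocks₁₂
        (T μ ε).toBlocks₂₁ (T μ ε).toBlocks₂₂ * sumDiffMatrix := by
      rw [Matrix.fromBlocks_toBlocks, hM]
      exact monodromy_stabilityMatrix hV ω μ hφε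
    obtain ⟨hplus, hminus⟩ := discriminants_conj sumDiffMatrix_mul hwr.1 hwr.2
    rw [← hMT] at hplus hminus
    have hex := hexp μ ε hμ hε
    rw [show monodromy (coupledHillMatrix V φ ω μ ε) = T μ ε from rfl,
      ← Matrix.fromBlocks_toBlocks (T μ ε)] at hex
    obtain ⟨b1, b2, b3⟩ := fromBlocks_expansion (adjugate_overlapMatrix U₁ U₂ _) hex
    beta_reduce
    generalize (T μ ε).toBlocks₁₁ = a at *
    generalize (T μ ε).toBlocks₁₂ = b at *
    generalize (T μ ε).toBlocks₂₁ = c at *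
    generalize (T μ ε).toBlocks₂₂ = d at *
    set s : ℂ := μ - μs with hs
    set η : ℝ := ‖s‖ + |ε| with hη
    have hη0 : 0 ≤ η := by positivity
    have hη1 : η ≤ 1 := by linarith
    have hsη : ‖s‖ ≤ η := le_add_of_nonneg_right (abs_nonneg _)
    have hεη : ‖(ε : ℂ)‖ ≤ η := by
      rw [Complex.norm_real]
      exact le_add_of_nonneg_left (norm_nonneg _)
    have hCD : 4 * (C * η ^ 2) ≤ D * η ^ 2 := by
      have := mul_le_mul_of_nonneg_right (le_abs_self C) (sq_nonneg η)
      rw [hD]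
      linarith
    refine ⟨?_, ?_, ?_, ?_⟩
    · rw [hplus]
      ring_nf
    · rw [hminus]
      ring_nf
    · have e : (a.trace + d.trace) / 2 - (k μs + (deriv k μs - deriv k (-μs)) / 2 * s +
          (t₁ + t₂) / 2 * ε) = 1 / 2 * ((a.trace + d.trace) - ((U₁ 1).trace + (U₂ 1).trace +
          (-2 * (U₁ 1 * overlapMatrix U₁ U₁ 1).trace + 2 * (U₂ 1 * overlapMatrix U₂ U₂ 1).trace) * s
          + (t₁ + t₂) * ε)) := by
        rw [hd₁, hd₂, ← hk₁, ← hk₂]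
        ring
      rw [e, norm_mul]
      have h1 : ‖(1 / 2 : ℂ)‖ ≤ 1 := by norm_num
      have h2 : η ^ 2 ≤ 2 * (|ε| ^ 2 + ‖s‖ ^ 2 + |ε| * ‖s‖) := by
        rw [hη]
        nlinarith [sq_nonneg |ε|, sq_nonneg ‖s‖]
      have h3 : 0 ≤ |ε| ^ 2 + ‖s‖ ^ 2 + |ε| * ‖s‖ := by positivity
      calc _ ≤ 1 * (D * η ^ 2) := by
            gcongr
            exact b1.trans hCD
        _ ≤ D * (2 * (|ε| ^ 2 + ‖s‖ ^ 2 + |ε| * ‖s‖)) := by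
            rw [one_mul]
            gcongr
        _ ≤ _ := by
            have : 0 ≤ 27 * (2 * L * D + D ^ 2) * (|ε| ^ 2 + ‖s‖ ^ 2 + |ε| * ‖s‖) := by positivity
            linarith
    · have hF : ‖(a.trace - d.trace) - (κ * s + (t₁ - t₂) * ε)‖ ≤ D * η ^ 2 := by
        refine (le_of_eq (congrArg _ ?_)).trans (b2.trans hCD)
        rw [hκ, hd₁, hd₂, ← hk₁, ← hk₂]
        ring
      have hF₀ : ‖κ * s + (t₁ - t₂) * ε‖ ≤ L * η := by
        refine (norm_add_le _ _).trans ?_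
        rw [norm_mul, norm_mul]
        have h1 := mul_le_mul_of_nonneg_left hsη (norm_nonneg κ)
        have h2 := mul_le_mul_of_nonneg_left hεη (norm_nonneg (t₁ - t₂))
        have h3 : 0 ≤ (∑ i, ∑ j, ‖Y i j‖) * η := by positivity
        rw [hL]
        linarith
      have hB : ∀ i j, ‖(b + c.adjugate) i j - ε * Y i j‖ ≤ D * η ^ 2 := fun i j =>
        (b3 i j).trans hCD
      have hB₀ : ∀ i j, ‖(ε : ℂ) * Y i j‖ ≤ L * η := by
        intro i j
        rw [norm_mul, mul_comm]
        exact mul_le_mul (hYL i j) hεη (norm_nonneg _) hL0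
      have n1 := norm_mul_sub_mul_le hD0 hη0 hη1 hF₀ hF₀ hF hF
      have n2 := norm_mul_sub_mul_le hD0 hη0 hη1 (hB₀ 0 0) (hB₀ 1 1) (hB 0 0) (hB 1 1)
      have n3 := norm_mul_sub_mul_le hD0 hη0 hη1 (hB₀ 0 1) (hB₀ 1 0) (hB 0 1) (hB 1 0)
      have e : (a.trace - d.trace) ^ 2 + 4 * (b + c.adjugate).det -
          (κ ^ 2 * s ^ 2 + 2 * κ * (t₁ - t₂) * ε * s + ((t₁ - t₂) ^ 2 + 4 * Y.det) * ε ^ 2) =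
          ((a.trace - d.trace) * (a.trace - d.trace) -
            (κ * s + (t₁ - t₂) * ε) * (κ * s + (t₁ - t₂) * ε)) +
          4 * ((b + c.adjugate) 0 0 * (b + c.adjugate) 1 1 - ε * Y 0 0 * (ε * Y 1 1)) -
          4 * ((b + c.adjugate) 0 1 * (b + c.adjugate) 1 0 - ε * Y 0 1 * (ε * Y 1 0)) := by
        rw [Matrix.det_fin_two, Matrix.det_fin_two]
        ring
      have h2 : η ^ 3 ≤ 3 * (|ε| ^ 3 + ‖s‖ ^ 3 + |ε| * ‖s‖ ^ 2 + |ε| ^ 2 * ‖s‖) := by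
        have p1 : 0 ≤ |ε| ^ 3 := by positivity
        have p2 : 0 ≤ ‖s‖ ^ 3 := by positivity
        rw [hη]
        linarith
      have hG : 0 ≤ 2 * L * D + D ^ 2 := by positivity
      rw [e]
      calc _ ≤ (2 * L * D + D ^ 2) * η ^ 3 + 4 * ((2 * L * D + D ^ 2) * η ^ 3) +
            4 * ((2 * L * D + D ^ 2) * η ^ 3) := by
            refine (norm_sub_le _ _).trans (add_le_add ((norm_add_le _ _).trans
              (add_le_add n1 ?_)) ?_)
            · rw [norm_mul, Complex.norm_ofNat]
              gcongr
            · rw [norm_mul, Complex.norm_ofNat]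
              gcongr
        _ = 9 * ((2 * L * D + D ^ 2) * η ^ 3) := by ring
        _ ≤ 9 * ((2 * L * D + D ^ 2) *
            (3 * (|ε| ^ 3 + ‖s‖ ^ 3 + |ε| * ‖s‖ ^ 2 + |ε| ^ 2 * ‖s‖))) := by gcongr
        _ ≤ _ := by
            have : 0 ≤ 2 * D * (|ε| ^ 3 + ‖s‖ ^ 3 + |ε| * ‖s‖ ^ 2 + |ε| ^ 2 * ‖s‖) := by
              positivity
            linarith
  · intro m hm
    subst hm
    have hi₁ := hr₁ (Complex.ofReal_im m)
    have hi₂ := hr₂ (by simp)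
    have hlift : ∀ N : Matrix (Fin 2) (Fin 2) ℂ, (∀ i j, (N i j).im = 0) →
        ∃ N' : Matrix (Fin 2) (Fin 2) ℝ, N = Complex.ofRealHom.mapMatrix N' := fun N hN =>
      ⟨N.map Complex.re, Matrix.ext fun i j => Complex.ext (by simp) (by simp [hN])⟩
    have htrace : ∀ N : Matrix (Fin 2) (Fin 2) ℝ,
        (Complex.ofRealHom.mapMatrix N).trace = (N.trace : ℂ) := fun N => by
      simp [Matrix.trace_fin_two]
    obtain ⟨m₁, hm₁⟩ := hlift (U₁ 1) (hi₁ 1)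
    obtain ⟨m₂, hm₂⟩ := hlift (U₂ 1) (hi₂ 1)
    obtain ⟨o₁, ho₁⟩ := hlift _ (im_overlapMatrix (f := 1) hi₁ hi₁ (by simp))
    obtain ⟨o₂, ho₂⟩ := hlift _ (im_overlapMatrix (f := 1) hi₂ hi₂ (by simp))
    obtain ⟨p₁, hp₁⟩ := hlift _ (im_overlapMatrix (f := fun x => f x) hi₁ hi₁ (by simp))
    obtain ⟨p₂, hp₂⟩ := hlift _ (im_overlapMatrix (f := fun x => f x) hi₂ hi₂ (by simp))
    obtain ⟨q, hq⟩ := hlift _ (im_overlapMatrix (f := fun x => g x) hi₁ hi₂ (by simp))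
    have et₁ : t₁ = ((m₁ * p₁).trace : ℂ) := by rw [ht₁, hm₁, hp₁, ← map_mul, htrace]
    have et₂ : t₂ = ((m₂ * p₂).trace : ℂ) := by rw [ht₂, hm₂, hp₂, ← map_mul, htrace]
    have ed₁ : deriv k m = ((-2 * (m₁ * o₁).trace : ℝ) : ℂ) := by
      rw [hd₁, hm₁, ho₁, ← map_mul, htrace]
      push_cast
      ring
    have ed₂ : deriv k (-m) = ((-2 * (m₂ * o₂).trace : ℝ) : ℂ) := by
      rw [hd₂, hm₂, ho₂, ← map_mul, htrace]
      push_cast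
      ring
    have eY : Y.det = ((m₁ * q - q * m₂.adjugate).det : ℂ) := by
      rw [hY, hm₁, hm₂, hq, ← RingHom.map_adjugate, ← map_mul, ← map_mul, ← map_sub,
        ← RingHom.map_det]
      rfl
    refine ⟨((m₁ * p₁).trace + (m₂ * p₂).trace) / 2,
      2 * (-2 * (m₁ * o₁).trace + -2 * (m₂ * o₂).trace) * ((m₁ * p₁).trace - (m₂ * p₂).trace),
      ((m₁ * p₁).trace - (m₂ * p₂).trace) ^ 2 + 4 * (m₁ * q - q * m₂.adjugate).det,
      ?_, ?_, ?_, ?_⟩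
    · rw [et₁, et₂]
      push_cast
      ring
    · rw [hκ, ed₁, ed₂, et₁, et₂]
      push_cast
      ring
    · rw [eY, et₁, et₂]
      push_cast
      ring
    intro hlow hup hsgn s e
    have hsq : (U₁ 1).trace.re ^ 2 < 4 := by
      rw [← hk₁]
      nlinarith
    have n₁ := mul_deriv_hillDiscriminant_neg hV hU₁ hi₁ hsq
    have n₂ := mul_deriv_hillDiscriminant_neg hV hU₂ hi₂ (by rwa [← hk₂, hk₁])
    rw [← hk] at n₁ n₂
    have hsign : 0 < m₁ 0 1 * m₂ 0 1 := by
      have e₁ : (U₁ 1 0 1).re = m₁ 0 1 := by simp [hm₁]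
      have e₂ : (U₂ 1 0 1).re = m₂ 0 1 := by simp [hm₂]
      rw [e₁] at n₁
      rw [e₂] at n₂
      -- `n₁` excludes `k'(m) = 0`
      rcases lt_trichotomy (deriv k m).re 0 with h | h | h
      · rw [sign_neg h, eq_comm, sign_eq_neg_one_iff] at hsgn
        exact mul_pos (pos_of_mul_neg_left n₁ h.le) (pos_of_mul_neg_left n₂ hsgn.le)
      · simp [h] at n₁
      · rw [sign_pos h, eq_comm, sign_eq_one_iff] at hsgn
        exact mul_pos_of_neg_of_neg (neg_of_mul_neg_left n₁ h.le) (neg_of_mul_neg_left n₂ hsgn.le)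
    have hdet : ∀ N : Matrix (Fin 2) (Fin 2) ℝ, (Complex.ofRealHom.mapMatrix N).det = 1 →
        N.det = 1 := fun N hN => by
      rw [← RingHom.map_det] at hN
      exact Complex.ofReal_injective (by simpa using hN)
    have htr : m₁.trace = m₂.trace := by
      have := hk₁.symm.trans hk₂
      rw [hm₁, hm₂, htrace, htrace] at this
      exact_mod_cast this
    have hnn := det_mul_sub_mul_adjugate_nonneg q
      (hdet m₁ (hm₁ ▸ det_eq_one_of_isSolutionOperator_hill hU₁ 1))
      (hdet m₂ (hm₂ ▸ det_eq_one_of_isSolutionOperator_hill hU₂ 1)) htr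
      (by rw [hm₁, htrace, Complex.ofReal_re] at hsq; exact hsq) hsign
    rw [ed₁, ed₂, Complex.ofReal_re, Complex.ofReal_re]
    -- the form is a square plus `4 e²` times a nonnegative determinant
    have hfin : 0 ≤ ((-2 * (m₁ * o₁).trace + -2 * (m₂ * o₂).trace) * s +
        ((m₁ * p₁).trace - (m₂ * p₂).trace) * e) ^ 2 +
        4 * (m₁ * q - q * m₂.adjugate).det * e ^ 2 := by positivity
    linarith
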